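/- **Hilbert–Mumford criterion for stability.** Let $W$ be a finite-dimensional hermitian vector space and $G\subset \mathrm{GL}(W)$ a connected complex reductive group, i.e. a connected Zariski closed subgroup that is the complexification of a compact subgroup $K$ ($\mathrm{Lie}\,G=\mathrm{Lie}\,K\oplus i\,\mathrm{Lie}\,K$). Let $H\subset G$ be a maximal compact subgroup that preserves the hermitian pairing, $\mathfrak h\subset \mathrm{End}(W)$ its real Lie algebra, and $X\subset W$ a $G$-stable Zariski closed subset (for instance a smooth affine variety with a $G$-action, equivariantly embedded in $W$). Fix a scalar product $\langle\cdot,\cdot\rangle$ on $\mathfrak h$ invariant under the adjoint action of $H$. Let $\mathcal X^*(G)$ be the group of linear (algebraic) characters $G\to\mathbb C^{\times}$ and $\chi^\theta\in\mathcal X^*(G)\otimes_{\mathbb Z}\mathbb R$. Let $\theta\in\mathfrak h$ be the element determined by $\langle\theta,Y\rangle=i\,d\chi^\theta_{\mathrm{Id}}(Y)$ for all $Y\in\mathfrak h$, where both $d\chi_{\mathrm{Id}}$ and the map $\chi\mapsto\log|\chi(g)|^2$ are extended from $\mathcal X^*(G)$ to $\mathcal X^*(G)\otimes\mathbb R$ by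 $\mathbb R$-linearity. For $x\in X$ let $$\phi^{\theta,x}:G\to\mathbb R,\qquad \phi^{\theta,x}(g)=\|g.x\|^2-\log\bigl(|\chi^\theta(g)|^2\bigr).$$ A point $x_0\in X$ is called $\theta$-semistable if there is $x\in\overline{G.x_0}$ such that $\phi^{\theta,x}$ has a minimum at the identity; $X^{\theta\text{-ss}}$ is the set of these points. A point of $X$ is called $\theta$-stable if it is $\theta$-semistable, its orbit is closed in $X^{\theta\text{-ss}}$, and its stabilizer in $G$ is finite. Then for every $x\in X$ the following are equivalent: (i) $x$ is $\theta$-stable; (ii) for every $Y\in\mathfrak h$, $Y\neq0$, such that $\lim_{t\to+\infty}\exp(itY).x$ exists, one has $\langle\theta,Y\rangle<0$. -/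

import Mathlib

open scoped TensorProduct InnerProductSpace
open Filter Topology

noncomputable section

namespace KempfNess

/-- A subset of a finite-dimensional complex normed space is Zariski closed if it is the set of
common zeros of a family of polynomials in the linear functionals on the space. -/
def IsZariskiClosed {V : Type*} [NormedAddCommGroup V] [NormedSpace ℂ V] (Z : Set V) : Prop :=
  ∃ S : Set (MvPolynomial (V →L[ℂ] ℂ) ℂ),
    Z = {v | ∀ p ∈ S, MvPolynomial.eval (fun l : V →L[ℂ] ℂ => l v) p = 0}

variable {W : Type*} [NormedAddCommGroup W] [InnerProductSpace ℂ W] [FiniteDimensional ℂ W]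

/-! ### The exponential map of `GL(W)` -/

theorem exp_mul_exp_neg (A : W →L[ℂ] W) : NormedSpace.exp A * NormedSpace.exp (-A) = 1 := by
  have : CompleteSpace W := FiniteDimensional.complete ℂ W
  let _ : NormedAlgebra ℚ (W →L[ℂ] W) := NormedAlgebra.restrictScalars ℚ ℂ _
  rw [← NormedSpace.exp_add_of_commute ((Commute.refl A).neg_right), add_neg_cancel,
    NormedSpace.exp_zero]

/-- The exponential of an endomorphism of `W`, as an element of `GL(W)`. -/
def expGL (A : W →L[ℂ] W) : (W →L[ℂ] W)ˣ where
  val := NormedSpace.exp A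
  inv := NormedSpace.exp (-A)
  val_inv := exp_mul_exp_neg A
  inv_val := by simpa using exp_mul_exp_neg (-A)

theorem hasDerivAt_exp (A : W →L[ℂ] W) :
    HasDerivAt (fun t : ℝ => NormedSpace.exp (t • A)) A 0 := by
  have : CompleteSpace W := FiniteDimensional.complete ℂ W
  simpa using hasDerivAt_exp_smul_const (𝕂 := ℝ) A (0 : ℝ)

theorem norm_pow_sub_pow_le {a b : W →L[ℂ] W} {r : ℝ} (ha : ‖a‖ ≤ r) (hb : ‖b‖ ≤ r)
    (hr : 1 ≤ r) (n : ℕ) : ‖a ^ n - b ^ n‖ ≤ n * r ^ n * ‖a - b‖ := by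
  have hr0 : 0 ≤ r := zero_le_one.trans hr
  have hpow : ∀ k : ℕ, ‖b ^ k‖ ≤ r ^ k := by
    intro k
    induction k with
    | zero =>
      rw [pow_zero, pow_zero]
      exact ContinuousLinearMap.norm_id_le (𝕜 := ℂ) (E := W)
    | succ k ih =>
      rw [pow_succ, pow_succ]
      exact (norm_mul_le _ _).trans (mul_le_mul ih hb (norm_nonneg _) (by positivity))
  induction n with
  | zero => simp
  | succ n ih =>
    have h : a ^ (n + 1) - b ^ (n + 1) = a * (a ^ n - b ^ n) + (a - b) * b ^ n := by
      rw [pow_succ' a, pow_succ' b]; noncomm_ring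
    rw [h]
    have h1 : ‖a * (a ^ n - b ^ n)‖ ≤ r * (n * r ^ n * ‖a - b‖) :=
      (norm_mul_le _ _).trans (mul_le_mul ha ih (norm_nonneg _) hr0)
    have h2 : ‖(a - b) * b ^ n‖ ≤ ‖a - b‖ * r ^ n :=
      (norm_mul_le _ _).trans (mul_le_mul_of_nonneg_left (hpow n) (norm_nonneg _))
    have h3 : r ^ n ≤ r ^ (n + 1) := pow_le_pow_right₀ hr (Nat.le_succ n)
    calc ‖a * (a ^ n - b ^ n) + (a - b) * b ^ n‖
        ≤ r * (n * r ^ n * ‖a - b‖) + ‖a - b‖ * r ^ n := (norm_add_le _ _).trans (add_le_add h1 h2)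
      _ ≤ r * (n * r ^ n * ‖a - b‖) + ‖a - b‖ * r ^ (n + 1) := by gcongr
      _ = ((n + 1 : ℕ) : ℝ) * r ^ (n + 1) * ‖a - b‖ := by push_cast; ring

/-- If `γ 0 = 1` and `γ' 0 = A` then `γ (1 / n) ^ n` tends to `exp A`. -/
theorem tendsto_pow_exp {γ : ℝ → (W →L[ℂ] W)} {A : W →L[ℂ] W} (h0 : γ 0 = 1)
    (hγ : HasDerivAt γ A 0) :
    Tendsto (fun n : ℕ => γ (((n : ℝ) + 1)⁻¹) ^ (n + 1)) atTop (𝓝 (NormedSpace.exp A)) := by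
  have : CompleteSpace W := FiniteDimensional.complete ℂ W
  let _ : NormedAlgebra ℚ (W →L[ℂ] W) := NormedAlgebra.restrictScalars ℚ ℂ _
  set ε : ℝ → (W →L[ℂ] W) := fun s => NormedSpace.exp (s • A) with hε
  have hε0 : ε 0 = 1 := by simp [hε]
  have hεd : HasDerivAt ε A 0 := hasDerivAt_exp A
  have hs : Tendsto (fun n : ℕ => ((n : ℝ) + 1)⁻¹) atTop (𝓝 0) := by
    simpa using tendsto_one_div_add_atTop_nhds_zero_nat (𝕜 := ℝ)
  have hbound : ∀ {δ : ℝ → (W →L[ℂ] W)}, δ 0 = 1 → HasDerivAt δ A 0 →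
      ∀ᶠ n : ℕ in atTop, ‖δ (((n : ℝ) + 1)⁻¹)‖ ≤ 1 + (‖A‖ + 1) * ((n : ℝ) + 1)⁻¹ := by
    intro δ hδ0 hδ
    have h1 : ∀ᶠ s in 𝓝 (0 : ℝ), ‖δ s - δ 0 - (s - 0) • A‖ ≤ 1 * ‖s - 0‖ :=
      (hasDerivAt_iff_isLittleO.1 hδ).def one_pos
    filter_upwards [hs.eventually h1] with n hn
    set s : ℝ := ((n : ℝ) + 1)⁻¹ with hsdef
    have hs0 : 0 ≤ s := by positivity
    simp only [sub_zero, hδ0, one_mul, Real.norm_of_nonneg hs0] at hn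
    have h2 : δ s = 1 + s • A + (δ s - 1 - s • A) := by abel
    have h3 : ‖(1 : W →L[ℂ] W)‖ ≤ 1 := ContinuousLinearMap.norm_id_le (𝕜 := ℂ) (E := W)
    have h4 : ‖s • A‖ ≤ s * ‖A‖ := by rw [norm_smul, Real.norm_of_nonneg hs0]
    rw [h2]
    calc ‖1 + s • A + (δ s - 1 - s • A)‖ ≤ ‖1 + s • A‖ + ‖δ s - 1 - s • A‖ := norm_add_le _ _
      _ ≤ ‖(1 : W →L[ℂ] W)‖ + ‖s • A‖ + ‖δ s - 1 - s • A‖ := by gcongr; exact norm_add_le _ _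
      _ ≤ 1 + (‖A‖ + 1) * s := by linarith
  have hdiff : Tendsto (fun n : ℕ => ((n : ℝ) + 1) *
      ‖γ (((n : ℝ) + 1)⁻¹) - ε (((n : ℝ) + 1)⁻¹)‖) atTop (𝓝 0) := by
    have hd : HasDerivAt (fun s => γ s - ε s) 0 0 := by
      have h := hγ.sub hεd
      rw [sub_self] at h
      exact h
    have h1 : (fun s : ℝ => γ s - ε s) =o[𝓝 0] fun s : ℝ => s := by
      simpa [h0, hε0] using hasDerivAt_iff_isLittleO.1 hd
    have h2 := (h1.comp_tendsto hs).norm_norm.tendsto_div_nhds_zero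
    refine h2.congr fun n => ?_
    have hn : (0 : ℝ) < (n : ℝ) + 1 := by positivity
    simp only [Function.comp, norm_inv, Real.norm_of_nonneg hn.le]
    field_simp
  have hpow : ∀ n : ℕ, ε (((n : ℝ) + 1)⁻¹) ^ (n + 1) = NormedSpace.exp A := by
    intro n
    have hn : ((n : ℝ) + 1) ≠ 0 := by positivity
    rw [hε]
    simp only
    rw [← NormedSpace.exp_nsmul, ← Nat.cast_smul_eq_nsmul ℝ, smul_smul]
    push_cast
    rw [mul_inv_cancel₀ hn, one_smul]
  rw [tendsto_iff_norm_sub_tendsto_zero]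
  have hlim : Tendsto (fun n : ℕ => Real.exp (‖A‖ + 1) * (((n : ℝ) + 1) *
      ‖γ (((n : ℝ) + 1)⁻¹) - ε (((n : ℝ) + 1)⁻¹)‖)) atTop (𝓝 0) := by
    simpa using hdiff.const_mul (Real.exp (‖A‖ + 1))
  refine squeeze_zero' (Eventually.of_forall fun n => norm_nonneg _) ?_ hlim
  filter_upwards [hbound h0 hγ, hbound hε0 hεd] with n h1 h2
  have hn : (0 : ℝ) < (n : ℝ) + 1 := by positivity
  have hr : (1 : ℝ) ≤ 1 + (‖A‖ + 1) * ((n : ℝ) + 1)⁻¹ := by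
    have : 0 ≤ (‖A‖ + 1) * ((n : ℝ) + 1)⁻¹ := by positivity
    linarith
  have h3 := norm_pow_sub_pow_le h1 h2 hr (n + 1)
  rw [hpow] at h3
  have h4 : (1 + (‖A‖ + 1) * ((n : ℝ) + 1)⁻¹) ^ (n + 1) ≤ Real.exp (‖A‖ + 1) := by
    have h5 : 1 + (‖A‖ + 1) * ((n : ℝ) + 1)⁻¹ ≤ Real.exp ((‖A‖ + 1) * ((n : ℝ) + 1)⁻¹) := by
      linarith [Real.add_one_le_exp ((‖A‖ + 1) * ((n : ℝ) + 1)⁻¹)]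
    refine (pow_le_pow_left₀ (by linarith) h5 (n + 1)).trans (le_of_eq ?_)
    rw [← Real.exp_nat_mul]
    congr 1
    push_cast
    field_simp
  refine h3.trans ?_
  push_cast
  calc ((n : ℝ) + 1) * (1 + (‖A‖ + 1) * ((n : ℝ) + 1)⁻¹) ^ (n + 1) *
        ‖γ (((n : ℝ) + 1)⁻¹) - ε (((n : ℝ) + 1)⁻¹)‖
      ≤ ((n : ℝ) + 1) * Real.exp (‖A‖ + 1) *
        ‖γ (((n : ℝ) + 1)⁻¹) - ε (((n : ℝ) + 1)⁻¹)‖ := by gcongr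
    _ = _ := by ring

/-! ### Lie algebras of closed subgroups of `GL(W)` -/

theorem expGL_add_mem {H : Subgroup (W →L[ℂ] W)ˣ} (hH : IsClosed (H : Set (W →L[ℂ] W)ˣ))
    {A B : W →L[ℂ] W} (hA : ∀ t : ℝ, expGL (t • A) ∈ H) (hB : ∀ t : ℝ, expGL (t • B) ∈ H)
    (t : ℝ) : expGL (t • (A + B)) ∈ H := by
  have : CompleteSpace W := FiniteDimensional.complete ℂ W
  have hd : HasDerivAt (fun s : ℝ => NormedSpace.exp (s • (t • A)) * NormedSpace.exp (s • (t • B)))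
      (t • A + t • B) 0 := by
    have h := (hasDerivAt_exp (t • A)).mul (hasDerivAt_exp (t • B))
    simp only [zero_smul, NormedSpace.exp_zero, mul_one, one_mul] at h
    exact h
  have hlim := tendsto_pow_exp (by simp) hd
  have hlim' : Tendsto (fun n : ℕ => (expGL (((n : ℝ) + 1)⁻¹ • (t • A)) *
      expGL (((n : ℝ) + 1)⁻¹ • (t • B))) ^ (n + 1)) atTop (𝓝 (expGL (t • (A + B)))) := by
    rw [Units.isOpenEmbedding_val.isEmbedding.tendsto_nhds_iff]
    simpa [Function.comp_def, expGL, smul_add] using hlim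
  refine hH.mem_of_tendsto hlim' (Eventually.of_forall fun n => ?_)
  refine H.pow_mem (H.mul_mem ?_ ?_) _
  · rw [smul_smul]; exact hA _
  · rw [smul_smul]; exact hB _

/-- The (real) Lie algebra of a closed subgroup `H` of `GL(W)`: the endomorphisms `A` of `W` with
`exp (t A) ∈ H` for all real `t`. -/
def lieAlgebra (H : Subgroup (W →L[ℂ] W)ˣ) (hH : IsClosed (H : Set (W →L[ℂ] W)ˣ)) :
    Submodule ℝ (W →L[ℂ] W) where
  carrier := {A | ∀ t : ℝ, expGL (t • A) ∈ H}
  zero_mem' := fun t => by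
    have : expGL (t • (0 : W →L[ℂ] W)) = 1 := by ext1; simp [expGL]
    rw [this]
    exact H.one_mem
  add_mem' := fun hA hB => expGL_add_mem hH hA hB
  smul_mem' := fun c A hA t => by
    rw [smul_smul]
    exact hA (t * c)

/-- The adjoint action `Y ↦ h Y h⁻¹` of `H` on its Lie algebra. -/
def Ad {H : Subgroup (W →L[ℂ] W)ˣ} {hH : IsClosed (H : Set (W →L[ℂ] W)ˣ)} (h : H)
    (Y : lieAlgebra H hH) : lieAlgebra H hH :=
  ⟨(h : (W →L[ℂ] W)ˣ) * (Y : W →L[ℂ] W) * ((h⁻¹ : H) : (W →L[ℂ] W)ˣ), fun t => by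
    have : CompleteSpace W := FiniteDimensional.complete ℂ W
    let _ : NormedAlgebra ℚ (W →L[ℂ] W) := NormedAlgebra.restrictScalars ℚ ℂ _
    have : expGL (t • (((h : (W →L[ℂ] W)ˣ) : W →L[ℂ] W) * (Y : W →L[ℂ] W) *
        (((h⁻¹ : H) : (W →L[ℂ] W)ˣ) : W →L[ℂ] W))) =
        (h : (W →L[ℂ] W)ˣ) * expGL (t • (Y : W →L[ℂ] W)) * ((h⁻¹ : H) : (W →L[ℂ] W)ˣ) := by
      ext1
      have := NormedSpace.exp_units_conj (h : (W →L[ℂ] W)ˣ) (t • (Y : W →L[ℂ] W))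
      simpa [expGL] using this
    rw [this]
    exact H.mul_mem (H.mul_mem h.2 (Y.2 t)) (h⁻¹).2⟩

/-! ### Reductive groups and their maximal compact subgroups -/

/-- `G` is a linear algebraic group: a Zariski closed subgroup of `GL(W)`. -/
def IsAlgebraicGroup (G : Subgroup (W →L[ℂ] W)ˣ) : Prop :=
  ∃ Z : Set (W →L[ℂ] W), IsZariskiClosed Z ∧ ∀ g : (W →L[ℂ] W)ˣ, g ∈ G ↔ (g : W →L[ℂ] W) ∈ Z

/-- `G` is a connected complex reductive group: a connected linear algebraic group that is the
complexification of some compact subgroup `K`, i.e. `Lie G = Lie K ⊕ i Lie K`. (Only the inclusion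
from left to right has to be asked for: the other one, and the directness of the sum, hold for every
compact subgroup of a complex linear algebraic group.) -/
structure IsConnectedReductive (G : Subgroup (W →L[ℂ] W)ˣ) : Prop where
  algebraic : IsAlgebraicGroup G
  connected : IsConnected (G : Set (W →L[ℂ] W)ˣ)
  complexification : ∃ K : Subgroup (W →L[ℂ] W)ˣ, K ≤ G ∧ IsCompact (K : Set (W →L[ℂ] W)ˣ) ∧
    ∀ A : W →L[ℂ] W, (∀ t : ℝ, expGL (t • A) ∈ G) →
      ∃ B C : W →L[ℂ] W, (∀ t : ℝ, expGL (t • B) ∈ K) ∧ (∀ t : ℝ, expGL (t • C) ∈ K) ∧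
        A = B + Complex.I • C

/-- `H` is a maximal compact subgroup of `G`. -/
structure IsMaximalCompact (G H : Subgroup (W →L[ℂ] W)ˣ) : Prop where
  le : H ≤ G
  compact : IsCompact (H : Set (W →L[ℂ] W)ˣ)
  maximal : ∀ K : Subgroup (W →L[ℂ] W)ˣ, K ≤ G → IsCompact (K : Set (W →L[ℂ] W)ˣ) → H ≤ K → K = H

theorem IsMaximalCompact.isClosed {G H : Subgroup (W →L[ℂ] W)ˣ} (h : IsMaximalCompact G H) :
    IsClosed (H : Set (W →L[ℂ] W)ˣ) :=
  h.compact.isClosed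

/-! ### Real characters -/

/-- The function on `GL(W)` defined by a polynomial in the entries of `g` and of `g⁻¹`. -/
def evalGL (P : MvPolynomial (((W →L[ℂ] W) →L[ℂ] ℂ) ⊕ ((W →L[ℂ] W) →L[ℂ] ℂ)) ℂ)
    (A B : W →L[ℂ] W) : ℂ :=
  MvPolynomial.eval (Sum.elim (fun l => l A) (fun l => l B)) P

/-- A function on `G ⊆ GL(W)` is regular if it is a polynomial in the entries of `g` and `g⁻¹`. -/
def IsRegular (G : Subgroup (W →L[ℂ] W)ˣ) (f : G → ℂ) : Prop :=
  ∃ P : MvPolynomial (((W →L[ℂ] W) →L[ℂ] ℂ) ⊕ ((W →L[ℂ] W) →L[ℂ] ℂ)) ℂ,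
    ∀ g : G, f g = evalGL P ((g : (W →L[ℂ] W)ˣ) : W →L[ℂ] W)
      (((g⁻¹ : G) : (W →L[ℂ] W)ˣ) : W →L[ℂ] W)

/-- The group `X^*(G)` of linear characters of `G`, i.e. of regular homomorphisms `G → ℂˣ`. -/
def characterGroup (G : Subgroup (W →L[ℂ] W)ˣ) : Subgroup (G →* ℂˣ) where
  carrier := {χ | IsRegular G fun g => (χ g : ℂ)}
  one_mem' := ⟨1, fun g => by simp [evalGL]⟩
  mul_mem' := by
    rintro χ ψ ⟨P, hP⟩ ⟨Q, hQ⟩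
    refine ⟨P * Q, fun g => ?_⟩
    have h1 := hP g
    have h2 := hQ g
    simp only [evalGL] at h1 h2 ⊢
    rw [map_mul, ← h1, ← h2]
    simp
  inv_mem' := by
    rintro χ ⟨P, hP⟩
    refine ⟨MvPolynomial.rename Sum.swap P, fun g => ?_⟩
    have h1 := hP g⁻¹
    simp only [evalGL, inv_inv] at h1 ⊢
    rw [MvPolynomial.eval_rename]
    have h2 : (Sum.elim (fun l : (W →L[ℂ] W) →L[ℂ] ℂ => l ((g : (W →L[ℂ] W)ˣ) : W →L[ℂ] W))
        (fun l : (W →L[ℂ] W) →L[ℂ] ℂ => l (((g⁻¹ : G) : (W →L[ℂ] W)ˣ) : W →L[ℂ] W))) ∘ Sum.swap =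
        Sum.elim (fun l => l (((g⁻¹ : G) : (W →L[ℂ] W)ˣ) : W →L[ℂ] W))
          (fun l => l ((g : (W →L[ℂ] W)ˣ) : W →L[ℂ] W)) := by
      ext (l | l) <;> rfl
    rw [h2, ← h1]
    simp

/-- The real vector space `X^*(G)^ℝ = ℝ ⊗ X^*(G)`. -/
abbrev RealCharacter (G : Subgroup (W →L[ℂ] W)ˣ) : Type _ :=
  ℝ ⊗[ℤ] Additive (characterGroup G)

/-- `log |χ(g)|²` for `χ ∈ X^*(G)^ℝ`, the linear extension of its values on linear characters. -/
def logAbsSq (G : Subgroup (W →L[ℂ] W)ˣ) (g : G) : RealCharacter G →ₗ[ℝ] ℝ :=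
  LinearMap.liftBaseChange ℝ
    (AddMonoidHom.toIntLinearMap
      ({ toFun := fun χ => Real.log (‖((χ.toMul : G →* ℂˣ) g : ℂ)‖ ^ 2)
         map_zero' := by simp
         map_add' := fun χ ψ => by
          simp only [toMul_add, Subgroup.coe_mul, MonoidHom.mul_apply, Units.val_mul, norm_mul,
            mul_pow]
          exact Real.log_mul (by simp) (by simp) } : Additive (characterGroup G) →+ ℝ))

/-! ### The element of the Lie algebra of `H` attached to a real character -/

theorem differentiable_evalGL
    (P : MvPolynomial (((W →L[ℂ] W) →L[ℂ] ℂ) ⊕ ((W →L[ℂ] W) →L[ℂ] ℂ)) ℂ) :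
    Differentiable ℝ (fun p : (W →L[ℂ] W) × (W →L[ℂ] W) => evalGL P p.1 p.2) := by
  induction P using MvPolynomial.induction_on with
  | C a => simp [evalGL]
  | add P Q hP hQ =>
    have h := hP.add hQ
    simpa [evalGL, Pi.add_def] using h
  | mul_X P i hP =>
    have hl : ∀ l : (W →L[ℂ] W) →L[ℂ] ℂ, Differentiable ℝ l := fun l =>
      (l.restrictScalars ℝ).differentiable
    rcases i with l | l
    · have h := hP.mul ((hl l).comp differentiable_fst)
      simpa [evalGL, Function.comp_def, Pi.mul_def] using h
    · have h := hP.mul ((hl l).comp differentiable_snd)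
      simpa [evalGL, Function.comp_def, Pi.mul_def] using h

/-- The value of the character `χ` of `G` at `exp (t Y)`, for `Y` in the Lie algebra of `H ≤ G`. -/
def charExp {G H : Subgroup (W →L[ℂ] W)ˣ} (hHG : H ≤ G)
    (hH : IsClosed (H : Set (W →L[ℂ] W)ˣ)) (χ : characterGroup G) (Y : lieAlgebra H hH) (t : ℝ) :
    ℂ :=
  ((χ : G →* ℂˣ) ⟨expGL (t • (Y : W →L[ℂ] W)), hHG (Y.2 t)⟩ : ℂˣ)

/-- The differential at the identity of the character `χ`, in the direction `Y`. -/
def charDeriv {G H : Subgroup (W →L[ℂ] W)ˣ} (hHG : H ≤ G)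
    (hH : IsClosed (H : Set (W →L[ℂ] W)ˣ)) (χ : characterGroup G) (Y : lieAlgebra H hH) : ℂ :=
  deriv (charExp hHG hH χ Y) 0

theorem exists_hasDerivAt_charExp {G H : Subgroup (W →L[ℂ] W)ˣ} (hHG : H ≤ G)
    (hH : IsClosed (H : Set (W →L[ℂ] W)ˣ)) (χ : characterGroup G) :
    ∃ D : lieAlgebra H hH →ₗ[ℝ] ℂ, ∀ Y, HasDerivAt (charExp hHG hH χ Y) (D Y) 0 := by
  obtain ⟨P, hP⟩ := χ.2
  set F := fun p : (W →L[ℂ] W) × (W →L[ℂ] W) => evalGL P p.1 p.2 with hF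
  have hFd : HasFDerivAt F (fderiv ℝ F (1, 1)) (1, 1) :=
    (differentiable_evalGL P _).hasFDerivAt
  refine ⟨(fderiv ℝ F (1, 1)).toLinearMap.comp
    (LinearMap.prod LinearMap.id (-LinearMap.id) ∘ₗ (lieAlgebra H hH).subtype), fun Y => ?_⟩
  have h1 : HasDerivAt (fun t : ℝ => NormedSpace.exp (t • (Y : W →L[ℂ] W))) (Y : W →L[ℂ] W) 0 :=
    hasDerivAt_exp _
  have h2 : HasDerivAt (fun t : ℝ => NormedSpace.exp (t • -(Y : W →L[ℂ] W)))
      (-(Y : W →L[ℂ] W)) 0 := hasDerivAt_exp _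
  have h3 := h1.prodMk h2
  have hFd' : HasFDerivAt F (fderiv ℝ F (1, 1))
      (NormedSpace.exp ((0 : ℝ) • (Y : W →L[ℂ] W)),
        NormedSpace.exp ((0 : ℝ) • -(Y : W →L[ℂ] W))) := by
    simpa using hFd
  have h4 := hFd'.comp_hasDerivAt (0 : ℝ) h3
  have h5 : charExp hHG hH χ Y = F ∘ fun t : ℝ =>
      (NormedSpace.exp (t • (Y : W →L[ℂ] W)), NormedSpace.exp (t • -(Y : W →L[ℂ] W))) := by
    funext t
    have h6 := hP ⟨expGL (t • (Y : W →L[ℂ] W)), hHG (Y.2 t)⟩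
    simp only [charExp, hF, Function.comp]
    rw [smul_neg]
    exact h6
  rw [h5]
  exact h4

/-- The real linear form `Y ↦ i dχ(Y)` on the Lie algebra of a compact subgroup `H` of `G`. (On the
Lie algebra of a compact group `dχ` has purely imaginary values, so that taking the real part
changes nothing.) -/
def charForm {G H : Subgroup (W →L[ℂ] W)ˣ} (hHG : H ≤ G)
    (hH : IsClosed (H : Set (W →L[ℂ] W)ˣ)) (χ : characterGroup G) :
    Module.Dual ℝ (lieAlgebra H hH) where
  toFun Y := (Complex.I * charDeriv hHG hH χ Y).re
  map_add' Y Z := by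
    obtain ⟨D, hD⟩ := exists_hasDerivAt_charExp hHG hH χ
    simp only [charDeriv, (hD _).deriv, map_add, mul_add, Complex.add_re]
  map_smul' c Y := by
    obtain ⟨D, hD⟩ := exists_hasDerivAt_charExp hHG hH χ
    simp only [charDeriv, (hD _).deriv, map_smul, RingHom.id_apply, mul_smul_comm,
      Complex.smul_re]

theorem charForm_mul {G H : Subgroup (W →L[ℂ] W)ˣ} (hHG : H ≤ G)
    (hH : IsClosed (H : Set (W →L[ℂ] W)ˣ)) (χ ψ : characterGroup G) :
    charForm hHG hH (χ * ψ) = charForm hHG hH χ + charForm hHG hH ψ := by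
  refine LinearMap.ext fun Y => ?_
  obtain ⟨D, hD⟩ := exists_hasDerivAt_charExp hHG hH χ
  obtain ⟨E, hE⟩ := exists_hasDerivAt_charExp hHG hH ψ
  have h1 : ∀ ξ : characterGroup G, charExp hHG hH ξ Y 0 = 1 := by
    intro ξ
    have : (⟨expGL ((0 : ℝ) • (Y : W →L[ℂ] W)), hHG (Y.2 0)⟩ : G) = 1 := by
      ext1; ext1; simp [expGL]
    rw [charExp, this, map_one, Units.val_one]
  have h2 : HasDerivAt (charExp hHG hH (χ * ψ) Y) (D Y + E Y) 0 := by
    have h3 := (hD Y).mul (hE Y)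
    rw [h1, h1, mul_one, one_mul] at h3
    have h4 : charExp hHG hH (χ * ψ) Y = charExp hHG hH χ Y * charExp hHG hH ψ Y := by
      funext t
      simp [charExp]
    rw [h4]
    exact h3
  change (Complex.I * charDeriv hHG hH (χ * ψ) Y).re =
    (Complex.I * charDeriv hHG hH χ Y).re + (Complex.I * charDeriv hHG hH ψ Y).re
  rw [charDeriv, charDeriv, charDeriv, h2.deriv, (hD Y).deriv, (hE Y).deriv, mul_add,
    Complex.add_re]

/-- The real linear form `i dχ` on the Lie algebra of `H`, extended linearly to all
`χ ∈ X^*(G)^ℝ`. -/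
def realCharForm {G H : Subgroup (W →L[ℂ] W)ˣ} (hHG : H ≤ G)
    (hH : IsClosed (H : Set (W →L[ℂ] W)ˣ)) :
    RealCharacter G →ₗ[ℝ] Module.Dual ℝ (lieAlgebra H hH) :=
  LinearMap.liftBaseChange ℝ
    (AddMonoidHom.toIntLinearMap
      (AddMonoidHom.mk' (fun χ : Additive (characterGroup G) => charForm hHG hH χ.toMul)
        fun χ ψ => charForm_mul hHG hH χ.toMul ψ.toMul))

/-- A scalar product on the Lie algebra of `H` invariant under the adjoint action. -/
structure InvariantScalarProduct (H : Subgroup (W →L[ℂ] W)ˣ)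
    (hH : IsClosed (H : Set (W →L[ℂ] W)ˣ)) where
  form : LinearMap.BilinForm ℝ (lieAlgebra H hH)
  symm : ∀ Y Z, form Y Z = form Z Y
  pos : ∀ Y, Y ≠ 0 → 0 < form Y Y
  invariant : ∀ (h : H) (Y Z), form (Ad h Y) (Ad h Z) = form Y Z

theorem InvariantScalarProduct.nondegenerate {H : Subgroup (W →L[ℂ] W)ˣ}
    {hH : IsClosed (H : Set (W →L[ℂ] W)ˣ)} (B : InvariantScalarProduct H hH) :
    B.form.Nondegenerate := by
  constructor
  · intro Y hY
    by_contra h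
    exact (B.pos Y h).ne' (hY Y)
  · intro Y hY
    by_contra h
    exact (B.pos Y h).ne' (hY Y)

/-- The map `ι` from `X^*(G)^ℝ` to the Lie algebra of `H`: `ι χ` is the element `θ` with
`⟨θ, Y⟩ = i dχ(Y)` for all `Y`. -/
def InvariantScalarProduct.iota {G H : Subgroup (W →L[ℂ] W)ˣ} {hH : IsClosed (H : Set (W →L[ℂ] W)ˣ)}
    (B : InvariantScalarProduct H hH) (hHG : H ≤ G) (χ : RealCharacter G) : lieAlgebra H hH :=
  haveI : FiniteDimensional ℝ (W →L[ℂ] W) := FiniteDimensional.complexToReal (W →L[ℂ] W)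
  (B.form.toDual B.nondegenerate).symm (realCharForm hHG hH χ)

/-! ### Stability -/

/-- The orbit of `x` under `G`. -/
def orbit (G : Subgroup (W →L[ℂ] W)ˣ) (x : W) : Set W :=
  {y | ∃ g ∈ G, (g : W →L[ℂ] W) x = y}

/-- The Kempf-Ness map `g ↦ ‖g x‖² - log |χ(g)|²` on `G`. -/
def kempfNess (G : Subgroup (W →L[ℂ] W)ˣ) (χ : RealCharacter G) (x : W) (g : G) : ℝ :=
  ‖((g : (W →L[ℂ] W)ˣ) : W →L[ℂ] W) x‖ ^ 2 - logAbsSq G g χ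

/-- The set of semistable points of `X`: the points whose orbit has in its closure a point the
Kempf-Ness map of which has a minimum at the identity. -/
def semistableSet (G : Subgroup (W →L[ℂ] W)ˣ) (X : Set W) (χ : RealCharacter G) : Set W :=
  {x₀ | x₀ ∈ X ∧ ∃ x ∈ closure (orbit G x₀), ∀ g : G, kempfNess G χ x 1 ≤ kempfNess G χ x g}

/-- A point is stable if it is semistable, its orbit is closed in the set of semistable points and
its stabilizer is finite. -/
structure IsStable (G : Subgroup (W →L[ℂ] W)ˣ) (X : Set W) (χ : RealCharacter G) (x : W) :
    Prop where
  semistable : x ∈ semistableSet G X χ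
  orbit_closed : IsClosed (((↑) : semistableSet G X χ → W) ⁻¹' orbit G x)
  finite_stabilizer : {g : (W →L[ℂ] W)ˣ | g ∈ G ∧ (g : W →L[ℂ] W) x = x}.Finite

end KempfNess

end

/-! Write E_x(Y) = ‖exp(iY)x‖² − 2⟨θ,Y⟩ for Y in 𝔥 (`PolarRep.energy`). By the polar decomposition G
= H exp(i𝔥) and the H-invariance of the Kempf-Ness function, E_x contains all the information about
φ^{θ,x}. As iY is self-adjoint, E_x restricted to a line through 0 is a nonnegative combination of
real exponentials minus a linear term, hence convex.

Along a ray, exp(itY)x either converges or grows exponentially (`tendsto_or_le_norm_exp_smul`). So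
(ii) forces E_x above E_x(0) somewhere on every ray, and convexity with compactness of the unit
sphere improves this to E_x(Y) ≥ a‖Y‖ − b with a > 0 (`PolarRep.exists_growth`). Then E_x attains a
minimum, which gives semistability. Moreover, if z is a minimal point, the slopes at infinity of E_y
are almost nonnegative for y near z. Comparing E_x at γ with E_y at γ⁻¹, where y = γx, bounds all γ
that carry x near z (`PolarRep.exists_eventually_mem_ball`). Hence the orbit is closed among
semistable points, and the stabilizer is bounded; its Lie algebra being complex, Liouville's theorem
makes it finite.

Conversely, the orbit of a stable point contains a minimal point z. A second minimum of E_z would,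
by the equality case of convexity, give a nontrivial exp(iY) fixing z, of infinite order. So the
minimum is strict and E_z grows linearly. If exp(itY)x stayed bounded for t ≥ 0 with ⟨θ,Y⟩ ≥ 0, the
Kempf-Ness function would be bounded above on the ray. Growth would then bound exp(itY) and its
inverse, so Y = 0.

The polar decomposition (`IsConnectedReductive.exists_eq_mul_exp`) comes from conjugating compact
subgroups into the unitary group by Cartan's fixed point argument. -/

namespace KempfNess

/-! ### Exponentials and compactness in `GL(W)`. -/

section Basics

variable {W : Type*} [NormedAddCommGroup W] [InnerProductSpace ℂ W] [FiniteDimensional ℂ W]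

theorem continuous_exp_endo : Continuous (NormedSpace.exp : (W →L[ℂ] W) → (W →L[ℂ] W)) := by
  have : CompleteSpace W := FiniteDimensional.complete ℂ W
  let _ : NormedAlgebra ℚ (W →L[ℂ] W) := NormedAlgebra.restrictScalars ℚ ℂ _
  exact NormedSpace.exp_continuous

@[simp] theorem val_expGL (A : W →L[ℂ] W) :
    ((expGL A : (W →L[ℂ] W)ˣ) : W →L[ℂ] W) = NormedSpace.exp A := rfl

@[simp] theorem expGL_zero : expGL (0 : W →L[ℂ] W) = 1 := by ext1; simp

theorem expGL_neg (A : W →L[ℂ] W) : expGL (-A) = (expGL A)⁻¹ := by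
  ext1; rfl

theorem expGL_add_of_commute {A B : W →L[ℂ] W} (h : Commute A B) :
    expGL (A + B) = expGL A * expGL B := by
  have : CompleteSpace W := FiniteDimensional.complete ℂ W
  let _ : NormedAlgebra ℚ (W →L[ℂ] W) := NormedAlgebra.restrictScalars ℚ ℂ _
  ext1
  simpa using NormedSpace.exp_add_of_commute h

theorem expGL_nsmul (n : ℕ) (A : W →L[ℂ] W) : expGL (n • A) = expGL A ^ n := by
  have : CompleteSpace W := FiniteDimensional.complete ℂ W
  let _ : NormedAlgebra ℚ (W →L[ℂ] W) := NormedAlgebra.restrictScalars ℚ ℂ _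
  ext1
  simpa using NormedSpace.exp_nsmul n A

theorem expGL_add_smul (z w : ℂ) (A : W →L[ℂ] W) :
    expGL ((z + w) • A) = expGL (z • A) * expGL (w • A) := by
  rw [add_smul]
  exact expGL_add_of_commute (((Commute.refl A).smul_left z).smul_right w)

theorem expGL_conj (u : (W →L[ℂ] W)ˣ) (A : W →L[ℂ] W) :
    expGL ((u : W →L[ℂ] W) * A * ((u⁻¹ : (W →L[ℂ] W)ˣ) : W →L[ℂ] W)) = u * expGL A * u⁻¹ := by
  have : CompleteSpace W := FiniteDimensional.complete ℂ W
  let _ : NormedAlgebra ℚ (W →L[ℂ] W) := NormedAlgebra.restrictScalars ℚ ℂ _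
  ext1
  simpa using NormedSpace.exp_units_conj u A

theorem isOpenEmbedding_unitsVal :
    Topology.IsOpenEmbedding (Units.val : (W →L[ℂ] W)ˣ → (W →L[ℂ] W)) := by
  have : CompleteSpace W := FiniteDimensional.complete ℂ W
  exact Units.isOpenEmbedding_val

theorem continuous_expGL : Continuous (expGL : (W →L[ℂ] W) → (W →L[ℂ] W)ˣ) :=
  isOpenEmbedding_unitsVal.isEmbedding.continuous_iff.2 continuous_exp_endo

theorem differentiable_exp_smul (A : W →L[ℂ] W) :
    Differentiable ℂ fun z : ℂ => NormedSpace.exp (z • A) := by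
  have : CompleteSpace W := FiniteDimensional.complete ℂ W
  exact fun z => (hasDerivAt_exp_smul_const (𝕂 := ℂ) A z).differentiableAt

theorem exp_apply_of_eigen {A : W →L[ℂ] W} {v : W} {c : ℂ} (h : A v = c • v) :
    NormedSpace.exp A v = Complex.exp c • v := by
  have : CompleteSpace W := FiniteDimensional.complete ℂ W
  have h1 := NormedSpace.exp_series_hasSum_exp' (𝕂 := ℂ) A
  have h2 := NormedSpace.exp_series_hasSum_exp' (𝕂 := ℂ) c
  rw [← Complex.exp_eq_exp_ℂ] at h2
  have h3 := (ContinuousLinearMap.apply ℂ W v).hasSum h1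
  have h4 := h2.smul_const v
  have hpow : ∀ n : ℕ, (A ^ n) v = c ^ n • v := by
    intro n
    induction n with
    | zero => simp
    | succ n ih => rw [pow_succ, mul_apply_eq_comp, h, map_smul, ih, smul_smul, pow_succ']
  refine h3.unique ?_
  convert h4 using 2 with n
  simp [hpow, smul_smul]

/-- A closed set of invertible endomorphisms that is bounded together with its inverses is
compact. -/
theorem isCompact_of_bounded_units {S : Set (W →L[ℂ] W)ˣ} (hS : IsClosed S) {C : ℝ}
    (h : ∀ u ∈ S, ‖(u : W →L[ℂ] W)‖ ≤ C ∧ ‖((u⁻¹ : (W →L[ℂ] W)ˣ) : W →L[ℂ] W)‖ ≤ C) :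
    IsCompact S := by
  have hp : ProperSpace (W →L[ℂ] W) := FiniteDimensional.proper ℂ _
  have hK : IsCompact (Metric.closedBall (0 : W →L[ℂ] W) C ×ˢ
      (MulOpposite.unop ⁻¹' Metric.closedBall (0 : W →L[ℂ] W) C)) := by
    refine (isCompact_closedBall _ _).prod ?_
    exact (MulOpposite.opHomeomorph.symm.isCompact_preimage).2 (isCompact_closedBall _ _)
  -- The units embed as a closed subset of pairs via u ↦ (u, u⁻¹), so no limit can become singular.
  have h1 := (Units.isClosedEmbedding_embedProduct (α := W →L[ℂ] W)).isCompact_preimage hK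
  refine h1.of_isClosed_subset hS fun u hu => ?_
  simpa [Units.embedProduct] using h u hu

end Basics

/-! ### Exponentials of self-adjoint endomorphisms. -/

section Spectral

variable {W : Type*} [NormedAddCommGroup W] [InnerProductSpace ℂ W] [FiniteDimensional ℂ W]
  [CompleteSpace W]

theorem exists_eigenbasis {A : W →L[ℂ] W} (hA : IsSelfAdjoint A) :
    ∃ (b : OrthonormalBasis (Fin (Module.finrank ℂ W)) ℂ W) (μ : Fin (Module.finrank ℂ W) → ℝ),
      ∀ i, A (b i) = (μ i : ℂ) • b i := by
  have hs : (A : W →ₗ[ℂ] W).IsSymmetric := ContinuousLinearMap.isSelfAdjoint_iff_isSymmetric.1 hA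
  exact ⟨hs.eigenvectorBasis rfl, hs.eigenvalues rfl, fun i => hs.apply_eigenvectorBasis rfl i⟩

theorem exp_smul_apply_eigen {A : W →L[ℂ] W} {v : W} {μ : ℝ} (h : A v = (μ : ℂ) • v) (z : ℂ) :
    NormedSpace.exp (z • A) v = Complex.exp (z * μ) • v :=
  exp_apply_of_eigen (by rw [smul_apply, h, smul_smul])

theorem exp_smul_apply_eq_sum {ι : Type*} [Fintype ι] {A : W →L[ℂ] W}
    {b : OrthonormalBasis ι ℂ W} {μ : ι → ℝ}
    (h : ∀ i, A (b i) = (μ i : ℂ) • b i) (z : ℂ) (v : W) :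
    NormedSpace.exp (z • A) v = ∑ i, (Complex.exp (z * μ i) * ⟪b i, v⟫_ℂ) • b i := by
  conv_lhs => rw [← b.sum_repr' v, map_sum]
  refine Finset.sum_congr rfl fun i _ => ?_
  rw [map_smul, exp_smul_apply_eigen (h i), smul_smul, mul_comm]

theorem norm_exp_smul_apply_sq {ι : Type*} [Fintype ι] {A : W →L[ℂ] W}
    {b : OrthonormalBasis ι ℂ W} {μ : ι → ℝ}
    (h : ∀ i, A (b i) = (μ i : ℂ) • b i) (t : ℝ) (v : W) :
    ‖NormedSpace.exp (t • A) v‖ ^ 2 = ∑ i, Real.exp (2 * t * μ i) * ‖⟪b i, v⟫_ℂ‖ ^ 2 := by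
  have h1 : t • A = (t : ℂ) • A := (Complex.coe_smul t A).symm
  rw [← b.sum_sq_norm_inner_right]
  refine Finset.sum_congr rfl fun i _ => ?_
  have h2 : ⟪b i, NormedSpace.exp (t • A) v⟫_ℂ = Complex.exp (t * μ i) * ⟪b i, v⟫_ℂ := by
    rw [h1, exp_smul_apply_eq_sum h, b.orthonormal.inner_right_fintype]
  rw [h2, norm_mul, mul_pow, Complex.norm_exp, ← Real.exp_nat_mul]
  congr 2
  simp
  ring

/-- The square of the distance between the end points of `t ↦ exp (t A) v` measures the failure of
`t ↦ ‖exp (t A) v‖²` to be affine on the midpoint. -/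
theorem norm_exp_apply_sub_sq {A : W →L[ℂ] W} (hA : IsSelfAdjoint A) (v : W) :
    ‖NormedSpace.exp A v - v‖ ^ 2 =
      ‖NormedSpace.exp A v‖ ^ 2 + ‖v‖ ^ 2 - 2 * ‖NormedSpace.exp ((1 / 2 : ℝ) • A) v‖ ^ 2 := by
  let _ : NormedAlgebra ℚ (W →L[ℂ] W) := NormedAlgebra.restrictScalars ℚ ℂ _
  have hB : IsSelfAdjoint ((1 / 2 : ℝ) • A) := (IsSelfAdjoint.all _).smul hA
  have h1 : NormedSpace.exp A =
      NormedSpace.exp ((1 / 2 : ℝ) • A) * NormedSpace.exp ((1 / 2 : ℝ) • A) := by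
    rw [← NormedSpace.exp_add_of_commute (Commute.refl _), ← add_smul]
    norm_num
  -- Half of the exponential moves across the inner product because exp(A/2) is self-adjoint.
  have h2 : ⟪NormedSpace.exp A v, v⟫_ℂ = ((‖NormedSpace.exp ((1 / 2 : ℝ) • A) v‖ ^ 2 : ℝ) : ℂ) := by
    rw [h1, mul_apply_eq_comp]
    have h3 := ContinuousLinearMap.isSelfAdjoint_iff_isSymmetric.1 hB.exp
    have h4 := h3 (NormedSpace.exp ((1 / 2 : ℝ) • A) v) v
    simp only [ContinuousLinearMap.coe_coe] at h4
    rw [h4, inner_self_eq_norm_sq_to_K]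
    norm_cast
  rw [@norm_sub_sq ℂ, h2]
  simp only [RCLike.re_to_complex, Complex.ofReal_re]
  ring

/-- The eigenvalues are real, and the real exponential takes the value 1 only at 0. This excludes
torsion among positive elements. -/
theorem eq_zero_of_exp_eq_one {A : W →L[ℂ] W} (hA : IsSelfAdjoint A)
    (h : NormedSpace.exp A = 1) : A = 0 := by
  obtain ⟨b, μ, hb⟩ := exists_eigenbasis hA
  have hμ : ∀ i, μ i = 0 := by
    intro i
    have h1 := exp_apply_of_eigen (hb i)
    rw [h, one_apply_eq_self] at h1
    have h2 : (1 - Complex.exp (μ i)) • b i = 0 := by rw [sub_smul, one_smul, ← h1, sub_self]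
    rcases smul_eq_zero.1 h2 with h3 | h3
    · have h4 : Real.exp (μ i) = 1 := by
        have : Complex.exp (μ i) = 1 := (sub_eq_zero.1 h3).symm
        exact_mod_cast this
      simpa using h4
    · exact absurd h3 (b.orthonormal.ne_zero i)
  ext v
  rw [← b.sum_repr' v]
  simp [hb, hμ]

end Spectral

/-! ### Zariski closed sets. -/

section Zariski

variable {V V' : Type*} [NormedAddCommGroup V] [NormedSpace ℂ V] [NormedAddCommGroup V']
  [NormedSpace ℂ V']

theorem IsZariskiClosed.isClosed {Z : Set V} (hZ : IsZariskiClosed Z) : IsClosed Z := by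
  obtain ⟨S, rfl⟩ := hZ
  have h : {v : V | ∀ p ∈ S, MvPolynomial.eval (fun l : V →L[ℂ] ℂ => l v) p = 0} =
      ⋂ p ∈ S, {v : V | MvPolynomial.eval (fun l : V →L[ℂ] ℂ => l v) p = 0} := by
    ext v; simp
  rw [h]
  refine isClosed_biInter fun p _ => isClosed_eq ?_ continuous_const
  exact (MvPolynomial.continuous_eval p).comp (continuous_pi fun l => l.continuous)

theorem IsZariskiClosed.preimage {Z : Set V} (hZ : IsZariskiClosed Z) (T : V' →L[ℂ] V) :
    IsZariskiClosed (T ⁻¹' Z) := by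
  obtain ⟨S, rfl⟩ := hZ
  refine ⟨MvPolynomial.rename (fun l : V →L[ℂ] ℂ => l.comp T) '' S, ?_⟩
  ext v
  simp [MvPolynomial.eval_rename, Function.comp_def]

end Zariski

/-! ### One-parameter groups in linear algebraic groups. -/

section Algebraic

variable {W : Type*} [NormedAddCommGroup W] [InnerProductSpace ℂ W] [FiniteDimensional ℂ W]

/-- The conjugate `g G g⁻¹` of a subgroup. -/
def conjSubgroup (g : (W →L[ℂ] W)ˣ) (G : Subgroup (W →L[ℂ] W)ˣ) : Subgroup (W →L[ℂ] W)ˣ :=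
  G.comap (MulAut.conj g⁻¹).toMonoidHom

theorem mem_conjSubgroup {g u : (W →L[ℂ] W)ˣ} {G : Subgroup (W →L[ℂ] W)ˣ} :
    u ∈ conjSubgroup g G ↔ g⁻¹ * u * g ∈ G := by
  simp [conjSubgroup]

theorem conj_mem_conjSubgroup {g u : (W →L[ℂ] W)ˣ} {G : Subgroup (W →L[ℂ] W)ˣ} (hu : u ∈ G) :
    g * u * g⁻¹ ∈ conjSubgroup g G := by
  rw [mem_conjSubgroup]
  simpa [mul_assoc] using hu

theorem coe_conjSubgroup (g : (W →L[ℂ] W)ˣ) (G : Subgroup (W →L[ℂ] W)ˣ) :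
    (conjSubgroup g G : Set (W →L[ℂ] W)ˣ) = (fun u => g * u * g⁻¹) '' G := by
  ext u
  constructor
  · intro hu
    exact ⟨g⁻¹ * u * g, mem_conjSubgroup.1 hu, by group⟩
  · rintro ⟨u, hu, rfl⟩
    exact conj_mem_conjSubgroup hu

theorem continuous_conj (g : (W →L[ℂ] W)ˣ) :
    Continuous fun u : (W →L[ℂ] W)ˣ => g * u * g⁻¹ := by fun_prop

theorem IsAlgebraicGroup.isClosed {G : Subgroup (W →L[ℂ] W)ˣ} (hG : IsAlgebraicGroup G) :
    IsClosed (G : Set (W →L[ℂ] W)ˣ) := by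
  obtain ⟨Z, hZ, h⟩ := hG
  have : (G : Set (W →L[ℂ] W)ˣ) = Units.val ⁻¹' Z := by ext g; exact h g
  rw [this]
  exact hZ.isClosed.preimage Units.continuous_val

theorem IsAlgebraicGroup.conj {G : Subgroup (W →L[ℂ] W)ˣ} (hG : IsAlgebraicGroup G)
    (g : (W →L[ℂ] W)ˣ) : IsAlgebraicGroup (conjSubgroup g G) := by
  obtain ⟨Z, hZ, h⟩ := hG
  refine ⟨_, hZ.preimage ((ContinuousLinearMap.mul ℂ (W →L[ℂ] W)
    ((g⁻¹ : (W →L[ℂ] W)ˣ) : W →L[ℂ] W)).comp ((ContinuousLinearMap.mul ℂ (W →L[ℂ] W)).flip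
    (g : W →L[ℂ] W))), fun u => ?_⟩
  rw [mem_conjSubgroup, h]
  simp [mul_assoc]

theorem isAlgebraicGroup_top : IsAlgebraicGroup (⊤ : Subgroup (W →L[ℂ] W)ˣ) :=
  ⟨Set.univ, ⟨∅, by simp⟩, by simp⟩

theorem differentiable_eval_exp (A : W →L[ℂ] W) (p : MvPolynomial ((W →L[ℂ] W) →L[ℂ] ℂ) ℂ) :
    Differentiable ℂ fun z : ℂ => MvPolynomial.eval
      (fun l : (W →L[ℂ] W) →L[ℂ] ℂ => l (NormedSpace.exp (z • A))) p := by
  induction p using MvPolynomial.induction_on with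
  | C a => simp
  | add p q hp hq => simpa [Pi.add_def] using hp.add hq
  | mul_X p l hp =>
    simpa [Pi.mul_def, Function.comp_def] using hp.mul (l.differentiable.comp (differentiable_exp_smul A))

/-- The Lie algebra of a linear algebraic group is a complex vector space. -/
theorem IsAlgebraicGroup.expGL_smul_mem {G : Subgroup (W →L[ℂ] W)ˣ} (hG : IsAlgebraicGroup G)
    {A : W →L[ℂ] W} (hA : ∀ t : ℝ, expGL (t • A) ∈ G) (z : ℂ) : expGL (z • A) ∈ G := by
  obtain ⟨Z, ⟨S, rfl⟩, h⟩ := hG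
  rw [h]
  intro p hp
  have h1 := (differentiable_eval_exp A p).differentiableOn.analyticOnNhd isOpen_univ
  -- The zeros at the real times 1/(n+1) accumulate at 0, so the identity theorem propagates them to
  -- all complex times.
  have h2 : ∃ᶠ z : ℂ in 𝓝[≠] 0, MvPolynomial.eval
      (fun l : (W →L[ℂ] W) →L[ℂ] ℂ => l (NormedSpace.exp (z • A))) p = 0 := by
    have h3 : Tendsto (fun n : ℕ => (((1 / ((n : ℝ) + 1) : ℝ)) : ℂ)) atTop (𝓝[≠] 0) := by
      refine tendsto_nhdsWithin_iff.2 ⟨?_, Eventually.of_forall fun n => ?_⟩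
      · have := (Complex.continuous_ofReal.tendsto 0).comp
          (tendsto_one_div_add_atTop_nhds_zero_nat (𝕜 := ℝ))
        simpa [Function.comp_def] using this
      · have : (0 : ℝ) < 1 / ((n : ℝ) + 1) := by positivity
        simpa only [Set.mem_compl_iff, Set.mem_singleton_iff, Complex.ofReal_eq_zero] using this.ne'
    refine h3.frequently (Frequently.of_forall fun n => ?_)
    have h4 := (h _).1 (hA (1 / ((n : ℝ) + 1))) p hp
    rwa [val_expGL, ← Complex.coe_smul] at h4
  exact congrFun (h1.eq_of_frequently_eq analyticOnNhd_const h2) z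

/-- The algebra of finite sums of functions `t ↦ c exp (μ t)` with `μ` real. -/
noncomputable def expPoly : AddMonoidAlgebra ℂ ℝ →ₐ[ℂ] (ℝ → ℂ) :=
  AddMonoidAlgebra.lift ℂ (ℝ → ℂ) ℝ
    { toFun := fun μ t => Complex.exp (t * μ.toAdd)
      map_one' := by ext; simp
      map_mul' := fun μ ν => by ext t; simp [mul_add, Complex.exp_add] }

theorem expPoly_apply (c : AddMonoidAlgebra ℂ ℝ) (t : ℝ) :
    expPoly c t = c.coeff.sum fun μ a => a * Complex.exp (t * μ) := by
  simp [expPoly, AddMonoidAlgebra.lift_apply, Finsupp.sum, Finset.sum_apply]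

theorem expPoly_single (μ : ℝ) (t : ℝ) :
    expPoly (AddMonoidAlgebra.single μ 1) t = Complex.exp (t * μ) := by
  simp [expPoly]

/-- The maps n ↦ exp(2nμ) are distinct characters of the monoid ℕ for distinct real μ, hence
linearly independent by Dedekind. -/
theorem expPoly_eq_zero {c : AddMonoidAlgebra ℂ ℝ} (h : ∀ n : ℕ, expPoly c (2 * n) = 0) :
    c = 0 := by
  set f : ℝ → (Multiplicative ℕ →* ℂ) := fun μ =>
    { toFun := fun n => Complex.exp (2 * n.toAdd * μ)
      map_one' := by simp
      map_mul' := fun m n => by simp [mul_add, add_mul, Complex.exp_add] } with hf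
  have hinj : Function.Injective f := by
    intro μ ν hμν
    have h1 := DFunLike.congr_fun hμν (Multiplicative.ofAdd 1)
    simp only [hf, MonoidHom.coe_mk, OneHom.coe_mk, toAdd_ofAdd, Nat.cast_one, mul_one] at h1
    have h2 : Real.exp (2 * μ) = Real.exp (2 * ν) := by exact_mod_cast h1
    linarith [Real.exp_injective h2]
  have hli := (linearIndependent_monoidHom (Multiplicative ℕ) ℂ).comp f hinj
  rw [linearIndependent_iff] at hli
  have h0 : c.coeff = 0 := by
    refine hli c.coeff (funext fun n => ?_)
    have h1 := h n.toAdd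
    rw [expPoly_apply] at h1
    rw [Finsupp.linearCombination_apply, Finsupp.sum, Finset.sum_apply]
    simpa [Finsupp.sum, hf] using h1
  ext μ
  simp [h0]

/-- In an eigenbasis, exp(tA) is the sum of the rank-one projectors weighted by exp(tμᵢ).
Polynomials in its entries are then exponential sums too, since these form an algebra. -/
theorem mem_range_expPoly {A : W →L[ℂ] W} [CompleteSpace W] (hA : IsSelfAdjoint A)
    (l : (W →L[ℂ] W) →L[ℂ] ℂ) :
    (fun t : ℝ => l (NormedSpace.exp (t • A))) ∈ expPoly.range := by
  obtain ⟨b, μ, hb⟩ := exists_eigenbasis hA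
  have h : (fun t : ℝ => l (NormedSpace.exp (t • A))) =
      ∑ i, l (InnerProductSpace.rankOne ℂ (b i) (b i)) • expPoly (AddMonoidAlgebra.single (μ i) 1) := by
    ext t
    have h1 : NormedSpace.exp (t • A) = ∑ i, Complex.exp (t * μ i) •
        InnerProductSpace.rankOne ℂ (b i) (b i) := by
      ext v
      rw [← Complex.coe_smul t A, exp_smul_apply_eq_sum hb]
      simp [smul_smul]
    rw [h1, map_sum, Finset.sum_apply]
    refine Finset.sum_congr rfl fun i _ => ?_
    rw [map_smul, Pi.smul_apply, expPoly_single, smul_eq_mul, smul_eq_mul, mul_comm]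
  rw [h]
  exact Subalgebra.sum_mem _ fun i _ => Subalgebra.smul_mem _ (AlgHom.mem_range_self _ _) _

/-- If a linear algebraic group contains the even powers of `exp A`, with `A` self-adjoint, then it
contains the one-parameter group of `A`. -/
theorem IsAlgebraicGroup.expGL_mem_of_pow [CompleteSpace W] {G : Subgroup (W →L[ℂ] W)ˣ}
    (hG : IsAlgebraicGroup G) {A : W →L[ℂ] W} (hA : IsSelfAdjoint A)
    (h2 : expGL ((2 : ℝ) • A) ∈ G) (t : ℝ) : expGL (t • A) ∈ G := by
  obtain ⟨Z, ⟨S, rfl⟩, h⟩ := hG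
  rw [h]
  intro p hp
  have hmem : (fun t : ℝ => MvPolynomial.eval
      (fun l : (W →L[ℂ] W) →L[ℂ] ℂ => l (NormedSpace.exp (t • A))) p) ∈ expPoly.range := by
    clear hp
    induction p using MvPolynomial.induction_on with
    | C a =>
      simp only [MvPolynomial.eval_C]
      exact expPoly.range.algebraMap_mem a
    | add p q hp hq =>
      simp only [map_add]
      exact expPoly.range.add_mem hp hq
    | mul_X p l hp =>
      simp only [map_mul, MvPolynomial.eval_X]
      exact expPoly.range.mul_mem hp (mem_range_expPoly hA l)
  obtain ⟨c, hc⟩ := hmem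
  -- The defining equations hold at the even times 2n because G contains the powers of exp(2A).
  have hc0 : c = 0 := by
    refine expPoly_eq_zero fun n => ?_
    have h3 : expGL ((2 * n : ℝ) • A) ∈ G := by
      have h4 := G.pow_mem h2 n
      rwa [← expGL_nsmul, ← Nat.cast_smul_eq_nsmul ℝ, smul_smul, mul_comm] at h4
    exact (congrFun hc _).trans ((h _).1 h3 p hp)
  have h5 := congrFun hc t
  rw [hc0] at h5
  simpa using h5.symm

end Algebraic

/-! ### The closed subgroup theorem and finiteness of bounded groups. -/

section ClosedSubgroup

/-- When `L` and `V` span, the derivative is onto, and every element near 1 factors as exp(a) exp(b)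
with small a ∈ `L`, b ∈ `V`. -/
theorem hasStrictFDerivAt_exp_mul_exp {𝔸 : Type*} [NormedRing 𝔸] [NormedAlgebra ℝ 𝔸]
    [CompleteSpace 𝔸] (L V : Submodule ℝ 𝔸) :
    HasStrictFDerivAt (fun p : L × V => NormedSpace.exp (p.1 : 𝔸) * NormedSpace.exp (p.2 : 𝔸))
      (L.subtypeL.coprod V.subtypeL) 0 := by
  have h1 : HasStrictFDerivAt (NormedSpace.exp : 𝔸 → 𝔸) (1 : 𝔸 →L[ℝ] 𝔸) 0 :=
    hasStrictFDerivAt_exp_zero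
  have h2 := (L.subtypeL.comp (ContinuousLinearMap.fst ℝ L V)).hasStrictFDerivAt (x := 0)
  have h3 := (V.subtypeL.comp (ContinuousLinearMap.snd ℝ L V)).hasStrictFDerivAt (x := 0)
  have h4 := HasStrictFDerivAt.comp (g := (NormedSpace.exp : 𝔸 → 𝔸)) (0 : L × V)
    (by simpa using h1) h2
  have h5 := HasStrictFDerivAt.comp (g := (NormedSpace.exp : 𝔸 → 𝔸)) (0 : L × V)
    (by simpa using h1) h3
  refine (h4.mul' h5).congr_fderiv (ContinuousLinearMap.ext fun p => ?_)
  simp [add_comm]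

variable {W : Type*} [NormedAddCommGroup W] [InnerProductSpace ℂ W] [FiniteDimensional ℂ W]

/-- A limit of directions of small elements `B` with `exp B ∈ G` is in the Lie algebra of `G`. -/
theorem mem_lieAlgebra_of_tendsto {G : Subgroup (W →L[ℂ] W)ˣ}
    (hG : IsClosed (G : Set (W →L[ℂ] W)ˣ)) {B : ℕ → (W →L[ℂ] W)} {A : W →L[ℂ] W}
    (hB : ∀ n, expGL (B n) ∈ G) (hB0 : ∀ n, B n ≠ 0) (hlim : Tendsto B atTop (𝓝 0))
    (hA : Tendsto (fun n => ‖B n‖⁻¹ • B n) atTop (𝓝 A)) : A ∈ lieAlgebra G hG := by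
  have key : ∀ t : ℝ, 0 ≤ t → expGL (t • A) ∈ G := by
    intro t ht
    have hn : Tendsto (fun n => ‖B n‖) atTop (𝓝 0) := by simpa using hlim.norm
    -- Integer multiples of the tiny ‖B n‖ approximate any t ≥ 0, so powers of exp(B n) approximate
    -- exp(tA).
    have h1 : Tendsto (fun n => (⌊t / ‖B n‖⌋₊ : ℝ) * ‖B n‖) atTop (𝓝 t) := by
      refine tendsto_of_tendsto_of_tendsto_of_le_of_le (g := fun n => t - ‖B n‖)
        (h := fun _ => t) ?_ tendsto_const_nhds (fun n => ?_) (fun n => ?_)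
      · simpa using hn.const_sub t
      · have hpos : 0 < ‖B n‖ := norm_pos_iff.2 (hB0 n)
        have := (Nat.lt_floor_add_one (t / ‖B n‖)).le
        rw [div_le_iff₀ hpos] at this
        simp only
        linarith
      · have hpos : 0 < ‖B n‖ := norm_pos_iff.2 (hB0 n)
        have := Nat.floor_le (div_nonneg ht hpos.le)
        rwa [le_div_iff₀ hpos] at this
    have h2 : Tendsto (fun n => ⌊t / ‖B n‖⌋₊ • B n) atTop (𝓝 (t • A)) := by
      refine (h1.smul hA).congr fun n => ?_
      have hpos : ‖B n‖ ≠ 0 := norm_ne_zero_iff.2 (hB0 n)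
      rw [smul_smul, mul_assoc, mul_inv_cancel₀ hpos, mul_one, Nat.cast_smul_eq_nsmul]
    refine hG.mem_of_tendsto ((continuous_expGL.tendsto _).comp h2) (Eventually.of_forall fun n => ?_)
    simp only [Function.comp, expGL_nsmul]
    exact G.pow_mem (hB n) _
  intro t
  rcases le_total 0 t with ht | ht
  · exact key t ht
  · have h := G.inv_mem (key (-t) (neg_nonneg.2 ht))
    rwa [← expGL_neg, neg_smul, neg_neg] at h

/-- **Closed subgroup theorem**: near the identity, a closed subgroup of `GL(W)` is the image of its
Lie algebra under the exponential map. -/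
theorem eventually_mem_exp_lieAlgebra {G : Subgroup (W →L[ℂ] W)ˣ}
    (hG : IsClosed (G : Set (W →L[ℂ] W)ˣ)) :
    ∀ᶠ u in 𝓝 (1 : (W →L[ℂ] W)ˣ), u ∈ G → ∃ A ∈ lieAlgebra G hG, u = expGL A := by
  have hfd : FiniteDimensional ℝ (W →L[ℂ] W) := FiniteDimensional.complexToReal (W →L[ℂ] W)
  have hproper : ProperSpace (W →L[ℂ] W) := FiniteDimensional.proper ℂ _
  have hcomp : CompleteSpace W := FiniteDimensional.complete ℂ W
  -- A complement of the Lie algebra detects the elements of G missed by the exponential map.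
  obtain ⟨V, hV⟩ := Submodule.exists_isCompl (lieAlgebra G hG)
  by_contra hcon
  have hfreq := not_eventually.1 hcon
  have hder : HasStrictFDerivAt (fun p : lieAlgebra G hG × V =>
      NormedSpace.exp (p.1 : W →L[ℂ] W) * NormedSpace.exp (p.2 : W →L[ℂ] W))
      ((lieAlgebra G hG).subtypeL.coprod V.subtypeL) 0 :=
    hasStrictFDerivAt_exp_mul_exp _ _
  have hsurj : ((lieAlgebra G hG).subtypeL.coprod V.subtypeL).range = ⊤ := by
    refine eq_top_iff.2 fun x _ => ?_
    have hx : x ∈ lieAlgebra G hG ⊔ V := by rw [hV.sup_eq_top]; trivial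
    obtain ⟨a, ha, b, hb, rfl⟩ := Submodule.mem_sup.1 hx
    exact ⟨(⟨a, ha⟩, ⟨b, hb⟩), rfl⟩
  have hmap := hder.map_nhds_eq_of_surj hsurj
  -- Factor a missed element as exp(a) exp(b) with a in the Lie algebra: then exp(b) ∈ G, and b ≠ 0.
  -- A limit direction of such b lies both in the Lie algebra and in `V`, yet has norm 1.
  have hsmall : ∀ ε > 0, ∃ B ∈ V, ‖B‖ < ε ∧ B ≠ 0 ∧ expGL B ∈ G := by
    intro ε hε
    have h1 : (fun p : lieAlgebra G hG × V =>
        NormedSpace.exp (p.1 : W →L[ℂ] W) * NormedSpace.exp (p.2 : W →L[ℂ] W)) '' Metric.ball 0 ε ∈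
        𝓝 (1 : W →L[ℂ] W) := by
      have h2 := image_mem_map (m := fun p : lieAlgebra G hG × V =>
        NormedSpace.exp (p.1 : W →L[ℂ] W) * NormedSpace.exp (p.2 : W →L[ℂ] W))
        (Metric.ball_mem_nhds (0 : lieAlgebra G hG × V) hε)
      rw [hmap] at h2
      simpa using h2
    have h3 := (Units.continuous_val (M := W →L[ℂ] W)).tendsto 1 h1
    obtain ⟨u, hu, p, hp, hpu⟩ := (hfreq.and_eventually h3).exists
    push Not at hu
    have hu' : u = expGL (p.1 : W →L[ℂ] W) * expGL (p.2 : W →L[ℂ] W) := by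
      ext1; exact hpu.symm
    refine ⟨p.2, p.2.2, ?_, ?_, ?_⟩
    · rw [mem_ball_zero_iff, Prod.norm_def] at hp
      exact (le_max_right _ _).trans_lt hp
    · intro h0
      rw [h0, expGL_zero, mul_one] at hu'
      exact hu.2 _ p.1.2 hu'
    · have h4 := G.mul_mem (G.inv_mem (p.1.2 1)) hu.1
      rwa [one_smul, hu', inv_mul_cancel_left] at h4
  choose B hBV hBn hB0 hBG using fun n : ℕ => hsmall (1 / ((n : ℝ) + 1)) (by positivity)
  have hlim : Tendsto B atTop (𝓝 0) :=
    squeeze_zero_norm (fun n => (hBn n).le) tendsto_one_div_add_atTop_nhds_zero_nat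
  have hS : ∀ n, ‖B n‖⁻¹ • B n ∈ Metric.sphere (0 : W →L[ℂ] W) 1 := by
    intro n
    rw [mem_sphere_zero_iff_norm, norm_smul, norm_inv, norm_norm,
      inv_mul_cancel₀ (norm_ne_zero_iff.2 (hB0 n))]
  obtain ⟨A, hA, φ, hφ, hAlim⟩ := (isCompact_sphere (0 : W →L[ℂ] W) 1).tendsto_subseq hS
  have hAG : A ∈ lieAlgebra G hG := mem_lieAlgebra_of_tendsto hG (B := B ∘ φ)
    (fun n => hBG _) (fun n => hB0 _) (hlim.comp hφ.tendsto_atTop) hAlim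
  have hAV : A ∈ V := (Submodule.closed_of_finiteDimensional V).mem_of_tendsto hAlim
    (Eventually.of_forall fun n => V.smul_mem _ (hBV _))
  have h0 : A = 0 := by
    have : A ∈ lieAlgebra G hG ⊓ V := ⟨hAG, hAV⟩
    rwa [hV.inf_eq_bot] at this
  rw [h0] at hA
  simp at hA

/-- A connected group is contained in a subgroup which it meets in a neighbourhood of `1`. -/
theorem le_of_eventually_mem {Γ : Type*} [TopologicalSpace Γ] [Group Γ] [IsTopologicalGroup Γ]
    {G S : Subgroup Γ} (hG : IsConnected (G : Set Γ)) (h : ∀ᶠ u in 𝓝 (1 : Γ), u ∈ G → u ∈ S) :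
    G ≤ S := by
  have : ConnectedSpace G := isConnected_iff_connectedSpace.1 hG
  have h1 : (S.subgroupOf G : Set G) ∈ 𝓝 (1 : G) := by
    have h2 := continuous_subtype_val.tendsto (1 : G) h
    filter_upwards [h2] with u hu
    exact hu u.2
  have hopen := Subgroup.isOpen_of_mem_nhds _ h1
  have hclopen : IsClopen (S.subgroupOf G : Set G) := ⟨Subgroup.isClosed_of_isOpen _ hopen, hopen⟩
  have huniv := hclopen.eq_univ ⟨1, one_mem _⟩
  intro g hg
  have : (⟨g, hg⟩ : G) ∈ (S.subgroupOf G : Set G) := by rw [huniv]; trivial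
  exact this

/-- A bounded closed subgroup whose Lie algebra is complex is finite. -/
theorem finite_of_bounded {S : Subgroup (W →L[ℂ] W)ˣ} (hS : IsClosed (S : Set (W →L[ℂ] W)ˣ))
    (hcplx : ∀ A : W →L[ℂ] W, (∀ t : ℝ, expGL (t • A) ∈ S) → ∀ z : ℂ, expGL (z • A) ∈ S)
    {C : ℝ} (hC : ∀ u ∈ S, ‖(u : W →L[ℂ] W)‖ ≤ C) : (S : Set (W →L[ℂ] W)ˣ).Finite := by
  have hlie : ∀ A ∈ lieAlgebra S hS, A = 0 := by
    intro A hA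
    -- Liouville: the entire function z ↦ exp(zA) stays in the bounded group, hence is constant, and
    -- A = 0.
    have hb : Bornology.IsBounded (Set.range fun z : ℂ => NormedSpace.exp (z • A)) := by
      refine isBounded_iff_forall_norm_le.2 ⟨C, ?_⟩
      rintro _ ⟨z, rfl⟩
      exact hC _ (hcplx A hA z)
    have hconst : (fun t : ℝ => NormedSpace.exp (t • A)) = fun _ => 1 := by
      funext t
      have h := (differentiable_exp_smul A).apply_eq_apply_of_bounded hb (t : ℂ) 0
      simpa using h
    have hd := hasDerivAt_exp A
    rw [hconst] at hd
    exact hd.unique (hasDerivAt_const _ _)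
  have hcompact : IsCompact (S : Set (W →L[ℂ] W)ˣ) :=
    isCompact_of_bounded_units hS fun u hu => ⟨hC u hu, hC _ (S.inv_mem hu)⟩
  have : CompactSpace S := isCompact_iff_compactSpace.1 hcompact
  have hnhds : ({1} : Set S) ∈ 𝓝 (1 : S) := by
    have h2 := continuous_subtype_val.tendsto (1 : S) (eventually_mem_exp_lieAlgebra hS)
    filter_upwards [h2] with u hu
    obtain ⟨A, hA, hu⟩ := hu u.2
    rw [hlie A hA, expGL_zero] at hu
    exact Subtype.ext hu
  have hopen : IsOpen ({1} : Set S) := by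
    have := Subgroup.isOpen_of_mem_nhds (⊥ : Subgroup S) (g := 1) (by simpa using hnhds)
    simpa using this
  have : DiscreteTopology S := discreteTopology_of_isOpen_singleton_one hopen
  have : Finite S := finite_of_compact_of_discrete
  exact Set.toFinite _

end ClosedSubgroup

/-! ### Polar decompositions and Cartan's fixed point theorem. -/

section Polar

variable {W : Type*} [NormedAddCommGroup W] [InnerProductSpace ℂ W] [FiniteDimensional ℂ W]
  [CompleteSpace W]

/-- A group of automorphisms has a polar decomposition if each of its elements is the product of a
unitary element and of the exponential of a self-adjoint element of its Lie algebra. -/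
def HasPolarDecomposition (L : Subgroup (W →L[ℂ] W)ˣ) : Prop :=
  ∀ g ∈ L, ∃ u ∈ L, ∃ A : W →L[ℂ] W, IsSelfAdjoint A ∧ (∀ t : ℝ, expGL (t • A) ∈ L) ∧
    star (u : W →L[ℂ] W) * u = 1 ∧ g = u * expGL A

/-- Take A = ½ log(g*g), built from the spectral projectors of g*g; its eigenvalues are positive
because g is injective. -/
theorem exists_isSelfAdjoint_exp_two_smul (g : (W →L[ℂ] W)ˣ) :
    ∃ A : W →L[ℂ] W, IsSelfAdjoint A ∧
      NormedSpace.exp ((2 : ℝ) • A) = star (g : W →L[ℂ] W) * (g : W →L[ℂ] W) := by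
  obtain ⟨b, μ, hb⟩ := exists_eigenbasis (IsSelfAdjoint.star_mul_self (g : W →L[ℂ] W))
  have hμ : ∀ i, 0 < μ i := by
    intro i
    have h1 : ⟪b i, (star (g : W →L[ℂ] W) * (g : W →L[ℂ] W)) (b i)⟫_ℂ =
        ((‖(g : W →L[ℂ] W) (b i)‖ ^ 2 : ℝ) : ℂ) := by
      rw [mul_apply_eq_comp, ContinuousLinearMap.star_eq_adjoint,
        ContinuousLinearMap.adjoint_inner_right, inner_self_eq_norm_sq_to_K]
      norm_cast
    rw [hb, inner_smul_right, inner_self_eq_norm_sq_to_K, b.orthonormal.1 i] at h1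
    have h2 : μ i = ‖(g : W →L[ℂ] W) (b i)‖ ^ 2 := by
      have : (μ i : ℂ) = ((‖(g : W →L[ℂ] W) (b i)‖ ^ 2 : ℝ) : ℂ) := by simpa using h1
      exact_mod_cast this
    rw [h2]
    have h3 : (g : W →L[ℂ] W) (b i) ≠ 0 := by
      intro h0
      have h4 : (((g⁻¹ : (W →L[ℂ] W)ˣ) : W →L[ℂ] W) * (g : W →L[ℂ] W)) (b i) = 0 := by
        rw [mul_apply_eq_comp, h0, map_zero]
      rw [Units.inv_mul] at h4
      exact b.orthonormal.ne_zero i h4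
    have := norm_pos_iff.2 h3
    positivity
  refine ⟨∑ i, ((Real.log (μ i) / 2 : ℝ) : ℂ) • InnerProductSpace.rankOne ℂ (b i) (b i), ?_, ?_⟩
  · refine isSelfAdjoint_sum _ fun i _ => IsSelfAdjoint.smul ?_ ?_
    · simp [IsSelfAdjoint]
    · simp [IsSelfAdjoint, ContinuousLinearMap.star_eq_adjoint]
  · have h : ∀ i, (∑ j, ((Real.log (μ j) / 2 : ℝ) : ℂ) •
        InnerProductSpace.rankOne ℂ (b j) (b j)) (b i) = ((Real.log (μ i) / 2 : ℝ) : ℂ) • b i := by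
      intro i
      simp [b.inner_eq_ite]
    rw [← Complex.coe_smul]
    refine ContinuousLinearMap.coe_injective (b.toBasis.ext fun i => ?_)
    simp only [OrthonormalBasis.coe_toBasis, ContinuousLinearMap.coe_coe]
    rw [exp_smul_apply_eigen (h i), hb]
    congr 1
    have : ((2 : ℝ) : ℂ) * ((Real.log (μ i) / 2 : ℝ) : ℂ) = ((Real.log (μ i) : ℝ) : ℂ) := by
      push_cast; ring
    rw [this, ← Complex.ofReal_exp, Real.exp_log (hμ i)]

/-- A linear algebraic group stable under taking adjoints has a polar decomposition. -/
theorem IsAlgebraicGroup.hasPolarDecomposition {G : Subgroup (W →L[ℂ] W)ˣ}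
    (hG : IsAlgebraicGroup G) (hstar : ∀ g ∈ G, star g ∈ G) : HasPolarDecomposition G := by
  intro g hg
  obtain ⟨A, hA, hexp⟩ := exists_isSelfAdjoint_exp_two_smul g
  have h2 : expGL ((2 : ℝ) • A) = star g * g := by
    ext1
    simpa using hexp
  -- Only exp(2A) = g*g is known to be in G; algebraicity recovers the whole one-parameter group, in
  -- particular the square root exp A.
  have hmem := hG.expGL_mem_of_pow hA (by rw [h2]; exact G.mul_mem (hstar g hg) hg)
  have h1 := hmem 1
  rw [one_smul] at h1
  refine ⟨g * (expGL A)⁻¹, G.mul_mem hg (G.inv_mem h1), A, hA, hmem, ?_, by group⟩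
  have hs : star (expGL A) = expGL A := by
    ext1
    exact hA.exp
  have h3 : star (g * (expGL A)⁻¹) * (g * (expGL A)⁻¹) = 1 := by
    rw [star_mul, star_inv, hs, mul_assoc, ← mul_assoc (star g), ← h2, two_smul,
      expGL_add_of_commute (Commute.refl A)]
    group
  simpa using congrArg Units.val h3

section NormSq

/-- The sum of the squares of the Hilbert-Schmidt norms of an automorphism and of its inverse. -/
noncomputable def unitsNormSq (u : (W →L[ℂ] W)ˣ) : ℝ :=
  ∑ i, (‖(u : W →L[ℂ] W) (stdOrthonormalBasis ℂ W i)‖ ^ 2 +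
    ‖star ((u⁻¹ : (W →L[ℂ] W)ˣ) : W →L[ℂ] W) (stdOrthonormalBasis ℂ W i)‖ ^ 2)

theorem continuous_unitsNormSq : Continuous (unitsNormSq : (W →L[ℂ] W)ˣ → ℝ) := by
  have h1 : Continuous fun u : (W →L[ℂ] W)ˣ => (u : W →L[ℂ] W) := Units.continuous_val
  have h2 : Continuous fun u : (W →L[ℂ] W)ˣ => star ((u⁻¹ : (W →L[ℂ] W)ˣ) : W →L[ℂ] W) :=
    (Units.continuous_val.comp continuous_inv).star
  refine continuous_finsetSum _ fun i _ => ?_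
  exact ((h1.clm_apply continuous_const).norm.pow 2).add
    ((h2.clm_apply continuous_const).norm.pow 2)

theorem norm_apply_of_star_mul_self {u : W →L[ℂ] W} (hu : star u * u = 1) (v : W) :
    ‖u v‖ = ‖v‖ := by
  have h1 : ⟪u v, u v⟫_ℂ = ⟪v, v⟫_ℂ := by
    rw [← ContinuousLinearMap.adjoint_inner_right, ← ContinuousLinearMap.star_eq_adjoint,
      ← mul_apply_eq_comp, hu, one_apply_eq_self]
  rw [inner_self_eq_norm_sq_to_K, inner_self_eq_norm_sq_to_K] at h1
  have h2 : ‖u v‖ ^ 2 = ‖v‖ ^ 2 := by exact_mod_cast h1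
  exact (sq_eq_sq₀ (norm_nonneg _) (norm_nonneg _)).1 h2

theorem val_inv_of_star_mul_self {u : (W →L[ℂ] W)ˣ} (hu : star (u : W →L[ℂ] W) * u = 1) :
    ((u⁻¹ : (W →L[ℂ] W)ˣ) : W →L[ℂ] W) = star (u : W →L[ℂ] W) :=
  (Units.eq_inv_of_mul_eq_one_right hu).symm

/-- Both g and the adjoint of g⁻¹ are multiplied on the left by the same unitary element; this is
why an adjoint appears in `unitsNormSq`. -/
theorem unitsNormSq_unitary_mul {u : (W →L[ℂ] W)ˣ} (hu : star (u : W →L[ℂ] W) * u = 1)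
    (g : (W →L[ℂ] W)ˣ) : unitsNormSq (u * g) = unitsNormSq g := by
  refine Finset.sum_congr rfl fun i _ => ?_
  rw [mul_inv_rev, Units.val_mul, Units.val_mul, star_mul, val_inv_of_star_mul_self hu, star_star,
    mul_apply_eq_comp, mul_apply_eq_comp, norm_apply_of_star_mul_self hu,
    norm_apply_of_star_mul_self hu]

/-- Midpoint convexity of `unitsNormSq` along exp(tA)g, with a defect term that vanishes only if exp
A = 1. It is `norm_exp_apply_sub_sq` for A and −A, discarding the defect of the inverse part. -/
theorem unitsNormSq_midpoint {A : W →L[ℂ] W} (hA : IsSelfAdjoint A) (g : (W →L[ℂ] W)ˣ) :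
    2 * unitsNormSq (expGL ((1 / 2 : ℝ) • A) * g) +
      ∑ i, ‖NormedSpace.exp A ((g : W →L[ℂ] W) (stdOrthonormalBasis ℂ W i)) -
        (g : W →L[ℂ] W) (stdOrthonormalBasis ℂ W i)‖ ^ 2 ≤
      unitsNormSq (expGL A * g) + unitsNormSq g := by
  simp only [unitsNormSq]
  rw [Finset.mul_sum, ← Finset.sum_add_distrib, ← Finset.sum_add_distrib]
  refine Finset.sum_le_sum fun i _ => ?_
  have hinv : ∀ B : W →L[ℂ] W, IsSelfAdjoint B → star (((expGL B * g)⁻¹ : (W →L[ℂ] W)ˣ) :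
      W →L[ℂ] W) = NormedSpace.exp (-B) * star ((g⁻¹ : (W →L[ℂ] W)ˣ) : W →L[ℂ] W) := by
    intro B hB
    rw [mul_inv_rev, Units.val_mul, star_mul, ← expGL_neg, val_expGL]
    congr 1
    exact hB.neg.exp
  rw [hinv A hA, hinv _ ((IsSelfAdjoint.all _).smul hA), Units.val_mul, Units.val_mul,
    mul_apply_eq_comp, mul_apply_eq_comp, mul_apply_eq_comp, mul_apply_eq_comp, val_expGL,
    val_expGL, norm_exp_apply_sub_sq hA, ← smul_neg]
  have h1 := norm_exp_apply_sub_sq hA.neg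
    (star ((g⁻¹ : (W →L[ℂ] W)ˣ) : W →L[ℂ] W) (stdOrthonormalBasis ℂ W i))
  have h2 := sq_nonneg ‖NormedSpace.exp (-A) (star ((g⁻¹ : (W →L[ℂ] W)ˣ) : W →L[ℂ] W)
    (stdOrthonormalBasis ℂ W i)) - star ((g⁻¹ : (W →L[ℂ] W)ˣ) : W →L[ℂ] W)
    (stdOrthonormalBasis ℂ W i)‖
  linarith

theorem norm_le_of_basis {T : W →L[ℂ] W} {c : ℝ} (hc : 0 ≤ c)
    (h : ∀ i, ‖T (stdOrthonormalBasis ℂ W i)‖ ≤ c) : ‖T‖ ≤ Module.finrank ℂ W * c := by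
  refine T.opNorm_le_bound (by positivity) fun v => ?_
  conv_lhs => rw [← (stdOrthonormalBasis ℂ W).sum_repr' v, map_sum]
  calc _ ≤ ∑ i, ‖T (⟪stdOrthonormalBasis ℂ W i, v⟫_ℂ • stdOrthonormalBasis ℂ W i)‖ :=
        norm_sum_le _ _
    _ ≤ ∑ i : Fin (Module.finrank ℂ W), ‖v‖ * c := by
        refine Finset.sum_le_sum fun i _ => ?_
        rw [map_smul, norm_smul]
        refine mul_le_mul ?_ (h i) (norm_nonneg _) (norm_nonneg _)
        simpa using norm_inner_le_norm (𝕜 := ℂ) (stdOrthonormalBasis ℂ W i) v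
    _ = _ := by simp; ring

/-- Including the inverse in `unitsNormSq` makes its sublevel sets bounded in `GL(W)`, so that
minima exist. -/
theorem norm_le_of_unitsNormSq_le {u : (W →L[ℂ] W)ˣ} {c : ℝ} (h : unitsNormSq u ≤ c) :
    ‖(u : W →L[ℂ] W)‖ ≤ Module.finrank ℂ W * √c ∧
      ‖((u⁻¹ : (W →L[ℂ] W)ˣ) : W →L[ℂ] W)‖ ≤ Module.finrank ℂ W * √c := by
  have h1 : ∀ i, ‖(u : W →L[ℂ] W) (stdOrthonormalBasis ℂ W i)‖ ^ 2 +
      ‖star ((u⁻¹ : (W →L[ℂ] W)ˣ) : W →L[ℂ] W) (stdOrthonormalBasis ℂ W i)‖ ^ 2 ≤ c := fun i =>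
    (Finset.single_le_sum (f := fun i => ‖(u : W →L[ℂ] W) (stdOrthonormalBasis ℂ W i)‖ ^ 2 +
      ‖star ((u⁻¹ : (W →L[ℂ] W)ˣ) : W →L[ℂ] W) (stdOrthonormalBasis ℂ W i)‖ ^ 2)
      (fun i _ => by positivity) (Finset.mem_univ i)).trans h
  constructor
  · refine norm_le_of_basis (Real.sqrt_nonneg _) fun i => Real.le_sqrt_of_sq_le ?_
    nlinarith [h1 i, sq_nonneg ‖star ((u⁻¹ : (W →L[ℂ] W)ˣ) : W →L[ℂ] W)
      (stdOrthonormalBasis ℂ W i)‖]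
  · rw [← norm_star]
    refine norm_le_of_basis (Real.sqrt_nonneg _) fun i => Real.le_sqrt_of_sq_le ?_
    nlinarith [h1 i, sq_nonneg ‖(u : W →L[ℂ] W) (stdOrthonormalBasis ℂ W i)‖]

end NormSq

/-- **Cartan's fixed point theorem**: a compact subgroup of a closed group with a polar
decomposition is conjugate to a group of unitary automorphisms. -/
theorem HasPolarDecomposition.exists_conj_unitary {L C : Subgroup (W →L[ℂ] W)ˣ}
    (hL : HasPolarDecomposition L) (hLc : IsClosed (L : Set (W →L[ℂ] W)ˣ)) (hCL : C ≤ L)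
    (hC : IsCompact (C : Set (W →L[ℂ] W)ˣ)) :
    ∃ g ∈ L, ∀ c ∈ C, star ((g * c * g⁻¹ : (W →L[ℂ] W)ˣ) : W →L[ℂ] W) *
      ((g * c * g⁻¹ : (W →L[ℂ] W)ˣ) : W →L[ℂ] W) = 1 := by
  -- A minimum of this maximum over C plays the role of the circumcentre of an orbit of C.
  set f : (W →L[ℂ] W)ˣ → ℝ := fun g => sSup ((fun c => unitsNormSq (g * c)) '' C) with hf
  have hcont : Continuous f :=
    hC.continuous_sSup (f := fun g c => unitsNormSq (g * c))
      (continuous_unitsNormSq.comp (continuous_fst.mul continuous_snd))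
  have himg : ∀ g, IsCompact ((fun c => unitsNormSq (g * c)) '' (C : Set (W →L[ℂ] W)ˣ)) := fun g =>
    hC.image (continuous_unitsNormSq.comp (continuous_const.mul continuous_id))
  have hle : ∀ g, ∀ c ∈ C, unitsNormSq (g * c) ≤ f g := fun g c hc =>
    le_csSup (himg g).bddAbove ⟨c, hc, rfl⟩
  have hex : ∀ g, ∃ c ∈ C, unitsNormSq (g * c) = f g := fun g =>
    (himg g).sSup_mem ⟨_, 1, C.one_mem, rfl⟩
  have hS : IsCompact ((L : Set (W →L[ℂ] W)ˣ) ∩ {g | f g ≤ f 1}) := by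
    refine isCompact_of_bounded_units (C := Module.finrank ℂ W * √(f 1))
      (hLc.inter (isClosed_le hcont continuous_const)) fun u hu => ?_
    refine norm_le_of_unitsNormSq_le (le_trans ?_ hu.2)
    simpa using hle u 1 C.one_mem
  obtain ⟨g, hg, hmin⟩ := hS.exists_isMinOn ⟨1, L.one_mem, le_refl (f 1)⟩ hcont.continuousOn
  have hmin' : ∀ γ ∈ L, f g ≤ f γ := by
    intro γ hγ
    rcases le_total (f γ) (f 1) with h | h
    · exact hmin ⟨hγ, h⟩
    · exact le_trans hg.2 h
  refine ⟨g, hg.1, fun c hc => ?_⟩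
  obtain ⟨u, -, A, hA, hAL, hu, hgc⟩ := hL _ (L.mul_mem (L.mul_mem hg.1 (hCL hc)) (L.inv_mem hg.1))
  -- Write gcg⁻¹ = u exp(A) and compare g with the midpoint exp(A/2)g. By minimality the midpoint
  -- does not lower `f`, while both end points have value at most `f g`; the convexity defect is
  -- zero, and exp A = 1.
  obtain ⟨c', hc', hmax⟩ := hex (expGL ((1 / 2 : ℝ) • A) * g)
  have h1 := unitsNormSq_midpoint hA (g * c')
  have h2 := hmin' _ (L.mul_mem (hAL (1 / 2)) hg.1)
  rw [← hmax, mul_assoc] at h2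
  have h3 := hle g c' hc'
  have h4 : unitsNormSq (expGL A * (g * c')) ≤ f g := by
    have h5 : u * (expGL A * (g * c')) = g * (c * c') := by
      rw [← mul_assoc, ← hgc]; group
    rw [← unitsNormSq_unitary_mul hu, h5]
    exact hle g _ (C.mul_mem hc hc')
  have h6 : ∑ i, ‖NormedSpace.exp A (((g * c' : (W →L[ℂ] W)ˣ) : W →L[ℂ] W)
      (stdOrthonormalBasis ℂ W i)) - ((g * c' : (W →L[ℂ] W)ˣ) : W →L[ℂ] W)
      (stdOrthonormalBasis ℂ W i)‖ ^ 2 = 0 :=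
    le_antisymm (by linarith) (Finset.sum_nonneg fun i _ => sq_nonneg _)
  rw [Finset.sum_eq_zero_iff_of_nonneg fun i _ => sq_nonneg _] at h6
  have h7 : expGL A * (g * c') = g * c' := by
    ext1
    refine ContinuousLinearMap.coe_injective ((stdOrthonormalBasis ℂ W).toBasis.ext fun i => ?_)
    have h8 := h6 i (Finset.mem_univ i)
    rw [sq_eq_zero_iff, norm_eq_zero, sub_eq_zero] at h8
    simpa using h8
  rw [mul_eq_right] at h7
  rw [hgc, h7, mul_one]
  exact hu

end Polar

/-! ### The decomposition `G = H exp(i Lie H)`. -/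

section Structure

variable {W : Type*} [NormedAddCommGroup W] [InnerProductSpace ℂ W] [FiniteDimensional ℂ W]

theorem expGL_smul_conj (g : (W →L[ℂ] W)ˣ) (A : W →L[ℂ] W) (t : ℝ) :
    expGL (t • ((g : W →L[ℂ] W) * A * ((g⁻¹ : (W →L[ℂ] W)ˣ) : W →L[ℂ] W))) =
      g * expGL (t • A) * g⁻¹ := by
  rw [← expGL_conj, mul_smul_comm, smul_mul_assoc]

/-- A one-parameter group of unitary automorphisms has a skew-adjoint generator. -/
theorem star_eq_neg_of_unitary [CompleteSpace W] {B : W →L[ℂ] W}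
    (h : ∀ t : ℝ, star (NormedSpace.exp (t • B)) * NormedSpace.exp (t • B) = 1) :
    star B = -B := by
  have h1 : ∀ t : ℝ, NormedSpace.exp (t • star B) = NormedSpace.exp (t • -B) := by
    intro t
    have h2 := val_inv_of_star_mul_self (u := expGL (t • B)) (h t)
    rw [← expGL_neg, val_expGL, val_expGL, NormedSpace.star_exp, star_smul, star_trivial,
      ← smul_neg] at h2
    exact h2.symm
  have h3 := hasDerivAt_exp (star B)
  simp only [h1] at h3
  exact h3.unique (hasDerivAt_exp (-B))

/-- A connected group, the Lie algebra of which is the complexification of the Lie algebra of a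
subgroup of unitary automorphisms, is stable under taking adjoints. -/
theorem star_mem_of_complexification [CompleteSpace W] {G : Subgroup (W →L[ℂ] W)ˣ}
    (hG : IsAlgebraicGroup G) (hconn : IsConnected (G : Set (W →L[ℂ] W)ˣ))
    {K : Subgroup (W →L[ℂ] W)ˣ} (hKG : K ≤ G)
    (hK : ∀ k ∈ K, star (k : W →L[ℂ] W) * (k : W →L[ℂ] W) = 1)
    (hlie : ∀ A : W →L[ℂ] W, (∀ t : ℝ, expGL (t • A) ∈ G) →
      ∃ B C : W →L[ℂ] W, (∀ t : ℝ, expGL (t • B) ∈ K) ∧ (∀ t : ℝ, expGL (t • C) ∈ K) ∧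
        A = B + Complex.I • C) :
    ∀ g ∈ G, star g ∈ G := by
  -- The Cartan involution. On the Lie algebra it sends B + iC to B − iC for skew-adjoint B and C,
  -- so it preserves G near 1, and everywhere by connectedness.
  let σ : (W →L[ℂ] W)ˣ →* (W →L[ℂ] W)ˣ :=
    { toFun := fun g => (star g)⁻¹
      map_one' := by simp
      map_mul' := fun a b => by simp }
  have hle : G ≤ G.comap σ := by
    refine le_of_eventually_mem hconn ?_
    filter_upwards [eventually_mem_exp_lieAlgebra hG.isClosed] with u hu huG
    obtain ⟨A, hA, rfl⟩ := hu huG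
    obtain ⟨B, C, hB, hC, rfl⟩ := hlie A hA
    have hskew : ∀ D : W →L[ℂ] W, (∀ t : ℝ, expGL (t • D) ∈ K) → star D = -D := fun D hD =>
      star_eq_neg_of_unitary fun t => by
        have h := hK _ (hD t)
        rwa [val_expGL] at h
    have hB' := hskew B hB
    have hC' := hskew C hC
    have h1 : σ (expGL (B + Complex.I • C)) = expGL (B + (-Complex.I) • C) := by
      change (star (expGL (B + Complex.I • C)))⁻¹ = _
      have h2 : star (expGL (B + Complex.I • C)) = expGL (star (B + Complex.I • C)) := by
        ext1
        exact NormedSpace.star_exp _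
      rw [h2, ← expGL_neg]
      congr 1
      rw [star_add, star_smul, hB', hC']
      simp [add_comm]
    rw [Subgroup.mem_comap, h1]
    have hBL : B ∈ lieAlgebra G hG.isClosed := fun t => hKG (hB t)
    have hCL : (-Complex.I) • C ∈ lieAlgebra G hG.isClosed := by
      intro t
      rw [← Complex.coe_smul, smul_smul]
      exact hG.expGL_smul_mem (fun t => hKG (hC t)) _
    have h3 := (lieAlgebra G hG.isClosed).add_mem hBL hCL 1
    rwa [one_smul] at h3
  intro g hg
  have h := G.inv_mem (hle hg)
  simpa [σ] using h

theorem isCompact_conjSubgroup {K : Subgroup (W →L[ℂ] W)ˣ}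
    (hK : IsCompact (K : Set (W →L[ℂ] W)ˣ)) (g : (W →L[ℂ] W)ˣ) :
    IsCompact (conjSubgroup g K : Set (W →L[ℂ] W)ˣ) := by
  rw [coe_conjSubgroup]
  exact hK.image (continuous_conj g)

/-- The unitary automorphisms, as a subgroup of `GL(W)`. -/
def unitarySubgroup (W : Type*) [NormedAddCommGroup W] [InnerProductSpace ℂ W] [CompleteSpace W] :
    Subgroup (W →L[ℂ] W)ˣ where
  carrier := {u | star (u : W →L[ℂ] W) * (u : W →L[ℂ] W) = 1}
  one_mem' := by simp
  mul_mem' := by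
    intro a b ha hb
    simp only [Set.mem_ofPred_eq, Units.val_mul, star_mul] at *
    rw [mul_assoc, ← mul_assoc (star (a : W →L[ℂ] W)), ha, one_mul, hb]
  inv_mem' := by
    intro a ha
    simp only [Set.mem_ofPred_eq] at *
    have h1 : ((a⁻¹ : (W →L[ℂ] W)ˣ) : W →L[ℂ] W) = star (a : W →L[ℂ] W) :=
      (Units.eq_inv_of_mul_eq_one_right ha).symm
    rw [h1, star_star, ← h1, a.mul_inv]

/-- A connected complex reductive group `G` with maximal compact subgroup `H` is
`H exp (i Lie H)`. -/
theorem IsConnectedReductive.exists_eq_mul_exp {G H : Subgroup (W →L[ℂ] W)ˣ}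
    (hG : IsConnectedReductive G) (hH : IsMaximalCompact G H) {γ : (W →L[ℂ] W)ˣ} (hγ : γ ∈ G) :
    ∃ h ∈ H, ∃ Y ∈ lieAlgebra H hH.isClosed, γ = h * expGL (Complex.I • Y) := by
  have hcomplete : CompleteSpace W := FiniteDimensional.complete ℂ W
  obtain ⟨K, hKG, hKc, hlie⟩ := hG.complexification
  have htop : HasPolarDecomposition (⊤ : Subgroup (W →L[ℂ] W)ˣ) :=
    isAlgebraicGroup_top.hasPolarDecomposition fun _ _ => Subgroup.mem_top _
  -- Conjugation by g₁ makes K unitary, so that the conjugate of G is stable under adjoints.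
  obtain ⟨g₁, -, hg₁⟩ := htop.exists_conj_unitary isClosed_univ le_top hKc
  have halg := hG.algebraic.conj g₁
  have hstar : ∀ g ∈ conjSubgroup g₁ G, star g ∈ conjSubgroup g₁ G := by
    refine star_mem_of_complexification halg ?_ (K := conjSubgroup g₁ K) ?_ ?_ ?_
    · rw [coe_conjSubgroup]
      exact hG.connected.image _ (continuous_conj g₁).continuousOn
    · intro u hu
      exact mem_conjSubgroup.2 (hKG (mem_conjSubgroup.1 hu))
    · intro k hk
      have h := hg₁ _ (mem_conjSubgroup.1 hk)
      simpa [mul_assoc] using h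
    · intro A hA
      obtain ⟨B, C, hB, hC, hABC⟩ := hlie
        (((g₁⁻¹ : (W →L[ℂ] W)ˣ) : W →L[ℂ] W) * A * (((g₁⁻¹)⁻¹ : (W →L[ℂ] W)ˣ) : W →L[ℂ] W))
        fun t => by
          rw [expGL_smul_conj, inv_inv]
          exact mem_conjSubgroup.1 (hA t)
      refine ⟨(g₁ : W →L[ℂ] W) * B * ((g₁⁻¹ : (W →L[ℂ] W)ˣ) : W →L[ℂ] W),
        (g₁ : W →L[ℂ] W) * C * ((g₁⁻¹ : (W →L[ℂ] W)ˣ) : W →L[ℂ] W), fun t => ?_, fun t => ?_, ?_⟩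
      · rw [expGL_smul_conj]
        exact conj_mem_conjSubgroup (hB t)
      · rw [expGL_smul_conj]
        exact conj_mem_conjSubgroup (hC t)
      · have h1 : A = (g₁ : W →L[ℂ] W) * (((g₁⁻¹ : (W →L[ℂ] W)ˣ) : W →L[ℂ] W) * A *
            (((g₁⁻¹)⁻¹ : (W →L[ℂ] W)ˣ) : W →L[ℂ] W)) *
            ((g₁⁻¹ : (W →L[ℂ] W)ˣ) : W →L[ℂ] W) := by
          simp [mul_assoc]
        rw [h1, hABC, mul_add, add_mul, mul_smul_comm, smul_mul_assoc]
  have hpol := halg.hasPolarDecomposition hstar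
  -- A second conjugation makes H unitary as well; as g₂ lies in the conjugated group, that group
  -- does not change.
  obtain ⟨g₂, hg₂G, hg₂⟩ := hpol.exists_conj_unitary halg.isClosed (C := conjSubgroup g₁ H)
    (fun u hu => mem_conjSubgroup.2 (hH.le (mem_conjSubgroup.1 hu)))
    (isCompact_conjSubgroup hH.compact g₁)
  set g := g₂ * g₁ with hg
  have hconj : ∀ u : (W →L[ℂ] W)ˣ, g * u * g⁻¹ ∈ conjSubgroup g₁ G ↔ u ∈ G := by
    intro u
    have h1 : g * u * g⁻¹ = g₂ * (g₁ * u * g₁⁻¹) * g₂⁻¹ := by rw [hg]; group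
    rw [h1, Subgroup.mul_mem_cancel_right _ (Subgroup.inv_mem _ hg₂G),
      Subgroup.mul_mem_cancel_left _ hg₂G, mem_conjSubgroup]
    simp [mul_assoc]
  set M : Subgroup (W →L[ℂ] W)ˣ := G ⊓ (unitarySubgroup W).comap (MulAut.conj g).toMonoidHom with hM
  have hmemM : ∀ u, u ∈ M ↔ u ∈ G ∧ star ((g * u * g⁻¹ : (W →L[ℂ] W)ˣ) : W →L[ℂ] W) *
      ((g * u * g⁻¹ : (W →L[ℂ] W)ˣ) : W →L[ℂ] W) = 1 := fun u => Iff.rfl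
  -- The elements of G that become unitary form a compact group containing H; maximality of H gives
  -- equality.
  have hMH : M = H := by
    refine hH.maximal M inf_le_left ?_ fun u hu => (hmemM u).2 ⟨hH.le hu, ?_⟩
    · have hclosed : IsClosed (M : Set (W →L[ℂ] W)ˣ) := by
        refine hG.algebraic.isClosed.inter (isClosed_eq ?_ continuous_const)
        have h1 := (Units.continuous_val (M := W →L[ℂ] W)).comp (continuous_conj g)
        exact h1.star.mul h1
      set c := ‖((g⁻¹ : (W →L[ℂ] W)ˣ) : W →L[ℂ] W)‖ * ‖(g : W →L[ℂ] W)‖ with hc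
      have hb : ∀ u ∈ M, ‖(u : W →L[ℂ] W)‖ ≤ c := by
        intro u hu
        have h1 : (u : W →L[ℂ] W) = ((g⁻¹ : (W →L[ℂ] W)ˣ) : W →L[ℂ] W) *
            ((g * u * g⁻¹ : (W →L[ℂ] W)ˣ) : W →L[ℂ] W) * (g : W →L[ℂ] W) := by
          rw [← Units.val_mul, ← Units.val_mul]
          congr 1
          group
        have h2 : ‖((g * u * g⁻¹ : (W →L[ℂ] W)ˣ) : W →L[ℂ] W)‖ ≤ 1 :=
          ContinuousLinearMap.opNorm_le_bound _ zero_le_one fun v => by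
            rw [norm_apply_of_star_mul_self ((hmemM u).1 hu).2, one_mul]
        rw [h1]
        refine (norm_mul_le _ _).trans (mul_le_mul_of_nonneg_right ?_ (norm_nonneg _))
        exact (norm_mul_le _ _).trans (mul_le_of_le_one_right (norm_nonneg _) h2)
      exact isCompact_of_bounded_units hclosed fun u hu => ⟨hb u hu, hb _ (M.inv_mem hu)⟩
    · have h1 := hg₂ _ (conj_mem_conjSubgroup (g := g₁) hu)
      have h2 : g₂ * (g₁ * u * g₁⁻¹) * g₂⁻¹ = g * u * g⁻¹ := by rw [hg]; group
      rwa [h2] at h1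
  obtain ⟨u, hu, A, hA, hAG, huu, hgu⟩ := hpol _ ((hconj γ).2 hγ)
  have hback : ∀ w : (W →L[ℂ] W)ˣ, w ∈ conjSubgroup g₁ G →
      star (w : W →L[ℂ] W) * (w : W →L[ℂ] W) = 1 → g⁻¹ * w * g ∈ H := by
    intro w hw hww
    have h1 : g * (g⁻¹ * w * g) * g⁻¹ = w := by group
    rw [← hMH, hmemM, h1]
    exact ⟨(hconj _).1 (by rwa [h1]), hww⟩
  -- Conjugate back the polar decomposition u exp(A) of gγg⁻¹: the witness is Y = g⁻¹(−iA)g, since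
  -- iY = g⁻¹Ag.
  refine ⟨g⁻¹ * u * g, hback u hu huu, ((g⁻¹ : (W →L[ℂ] W)ˣ) : W →L[ℂ] W) *
    ((-Complex.I) • A) * (((g⁻¹)⁻¹ : (W →L[ℂ] W)ˣ) : W →L[ℂ] W), fun t => ?_, ?_⟩
  · rw [expGL_smul_conj, inv_inv]
    refine hback _ ?_ ?_
    · rw [← Complex.coe_smul, smul_smul]
      exact halg.expGL_smul_mem hAG _
    · have h1 : star (t • -Complex.I • A) = -(t • -Complex.I • A) := by
        rw [star_smul, star_smul, hA.star_eq]
        simp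
      rw [val_expGL, NormedSpace.star_exp, h1]
      simpa using exp_mul_exp_neg (-(t • -Complex.I • A))
  · have h1 : Complex.I • (((g⁻¹ : (W →L[ℂ] W)ˣ) : W →L[ℂ] W) *
        ((-Complex.I) • A) * (((g⁻¹)⁻¹ : (W →L[ℂ] W)ˣ) : W →L[ℂ] W)) =
        ((g⁻¹ : (W →L[ℂ] W)ˣ) : W →L[ℂ] W) * A * (((g⁻¹)⁻¹ : (W →L[ℂ] W)ˣ) : W →L[ℂ] W) := by
      rw [mul_smul_comm, smul_mul_assoc, smul_smul]
      simp
    rw [h1, expGL_conj]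
    have h2 : γ = g⁻¹ * (g * γ * g⁻¹) * g := by group
    rw [h2, hgu]
    group

end Structure

/-! ### Real characters on `H` and on `exp(i Lie H)`. -/

section Characters

variable {W : Type*} [NormedAddCommGroup W] [InnerProductSpace ℂ W] [FiniteDimensional ℂ W]
  {G H : Subgroup (W →L[ℂ] W)ˣ}

theorem continuous_character (χ : characterGroup G) :
    Continuous fun g : G => (((χ : G →* ℂˣ) g : ℂˣ) : ℂ) := by
  obtain ⟨P, hP⟩ := χ.2
  have h1 : Continuous fun g : G => evalGL P ((g : (W →L[ℂ] W)ˣ) : W →L[ℂ] W)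
      (((g⁻¹ : G) : (W →L[ℂ] W)ˣ) : W →L[ℂ] W) := by
    have h2 : Continuous fun g : G => ((g : (W →L[ℂ] W)ˣ) : W →L[ℂ] W) :=
      Units.continuous_val.comp continuous_subtype_val
    have h3 : Continuous fun g : G => (((g⁻¹ : G) : (W →L[ℂ] W)ˣ) : W →L[ℂ] W) :=
      Units.continuous_val.comp (continuous_subtype_val.comp continuous_inv)
    have h4 : Continuous fun p : (W →L[ℂ] W) × (W →L[ℂ] W) => evalGL P p.1 p.2 :=
      (differentiable_evalGL P).continuous
    have h5 := h4.comp (h2.prodMk h3)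
    simpa only [Function.comp_def] using h5
  exact h1.congr fun g => (hP g).symm

/-- If |χ(k)| > 1 then |χ(kⁿ)| is unbounded on a compact group; apply this to h and to h⁻¹. -/
theorem norm_character_eq_one (hHG : H ≤ G) (hH : IsCompact (H : Set (W →L[ℂ] W)ˣ))
    (χ : characterGroup G) {h : (W →L[ℂ] W)ˣ} (hh : h ∈ H) :
    ‖(((χ : G →* ℂˣ) ⟨h, hHG hh⟩ : ℂˣ) : ℂ)‖ = 1 := by
  have hc : CompactSpace H := isCompact_iff_compactSpace.1 hH
  have hcont : Continuous fun k : H => ‖(((χ : G →* ℂˣ) ⟨k, hHG k.2⟩ : ℂˣ) : ℂ)‖ :=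
    ((continuous_character χ).comp (continuous_subtype_val.subtype_mk fun k => hHG k.2)).norm
  obtain ⟨C, hC⟩ := (isCompact_range hcont).bddAbove
  have hle : ∀ (k : (W →L[ℂ] W)ˣ) (hk : k ∈ H),
      ‖(((χ : G →* ℂˣ) ⟨k, hHG hk⟩ : ℂˣ) : ℂ)‖ ≤ 1 := by
    intro k hk
    by_contra! hlt
    obtain ⟨n, hn⟩ := pow_unbounded_of_one_lt C hlt
    have h1 := hC ⟨⟨k ^ n, H.pow_mem hk n⟩, rfl⟩
    have h2 : (⟨k ^ n, hHG (H.pow_mem hk n)⟩ : G) = ⟨k, hHG hk⟩ ^ n := rfl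
    simp only [h2, map_pow, Units.val_pow_eq_pow_val, norm_pow] at h1
    exact absurd hn (not_lt.2 h1)
  refine le_antisymm (hle h hh) ?_
  have h1 := hle h⁻¹ (H.inv_mem hh)
  have h2 : (⟨h⁻¹, hHG (H.inv_mem hh)⟩ : G) = ⟨h, hHG hh⟩⁻¹ := rfl
  rw [h2, map_inv, Units.val_inv_eq_inv_val, norm_inv] at h1
  exact (inv_le_one₀ (by simp)).1 h1

theorem logAbsSq_tmul (g : G) (r : ℝ) (χ : Additive (characterGroup G)) :
    logAbsSq G g (r ⊗ₜ[ℤ] χ) = r * Real.log (‖(((χ.toMul : G →* ℂˣ) g : ℂˣ) : ℂ)‖ ^ 2) := by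
  simp [logAbsSq]

theorem log_norm_sq_map_mul {Γ : Type*} [Group Γ] (ψ : Γ →* ℂˣ) (g g' : Γ) :
    Real.log (‖((ψ (g * g') : ℂˣ) : ℂ)‖ ^ 2) =
      Real.log (‖((ψ g : ℂˣ) : ℂ)‖ ^ 2) + Real.log (‖((ψ g' : ℂˣ) : ℂ)‖ ^ 2) := by
  rw [map_mul, Units.val_mul, norm_mul, mul_pow, Real.log_mul (by simp) (by simp)]

theorem logAbsSq_mul_tmul (g g' : G) (r : ℝ) (χ : Additive (characterGroup G)) :
    logAbsSq G (g * g') (r ⊗ₜ[ℤ] χ) =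
      logAbsSq G g (r ⊗ₜ[ℤ] χ) + logAbsSq G g' (r ⊗ₜ[ℤ] χ) := by
  refine (logAbsSq_tmul _ r χ).trans ?_
  rw [log_norm_sq_map_mul (χ.toMul : G →* ℂˣ), mul_add, logAbsSq_tmul, logAbsSq_tmul]

theorem linearMap_apply_eq_add_of_tmul {M : Type*} [AddCommGroup M] {a b c : ℝ ⊗[ℤ] M →ₗ[ℝ] ℝ}
    (h : ∀ (r : ℝ) (m : M), a (r ⊗ₜ[ℤ] m) = b (r ⊗ₜ[ℤ] m) + c (r ⊗ₜ[ℤ] m)) (x : ℝ ⊗[ℤ] M) :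
    a x = b x + c x := by
  induction x using TensorProduct.induction_on with
  | zero => simp
  | tmul r m => exact h r m
  | add x y hx hy => rw [map_add a, map_add b, map_add c, hx, hy, add_add_add_comm]

theorem logAbsSq_mul (g g' : G) (χ : RealCharacter G) :
    logAbsSq G (g * g') χ = logAbsSq G g χ + logAbsSq G g' χ :=
  linearMap_apply_eq_add_of_tmul (logAbsSq_mul_tmul g g') χ

theorem logAbsSq_eq_zero (hHG : H ≤ G) (hH : IsCompact (H : Set (W →L[ℂ] W)ˣ))
    (χ : RealCharacter G) {h : (W →L[ℂ] W)ˣ} (hh : h ∈ H) : logAbsSq G ⟨h, hHG hh⟩ χ = 0 := by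
  induction χ using TensorProduct.induction_on with
  | zero => simp
  | tmul r χ => rw [logAbsSq_tmul, norm_character_eq_one hHG hH χ.toMul hh]; simp
  | add x y hx hy => rw [map_add, hx, hy, add_zero]

theorem differentiable_evalGL_exp (A : W →L[ℂ] W)
    (P : MvPolynomial (((W →L[ℂ] W) →L[ℂ] ℂ) ⊕ ((W →L[ℂ] W) →L[ℂ] ℂ)) ℂ) :
    Differentiable ℂ fun z : ℂ =>
      evalGL P (NormedSpace.exp (z • A)) (NormedSpace.exp (-(z • A))) := by
  have hneg : Differentiable ℂ fun z : ℂ => NormedSpace.exp (-(z • A)) := by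
    simpa using differentiable_exp_smul (-A)
  induction P using MvPolynomial.induction_on with
  | C a => simp [evalGL]
  | add p q hp hq => simpa [evalGL, Pi.add_def] using hp.add hq
  | mul_X p l hp =>
    rcases l with l | l
    · simpa [evalGL, Pi.mul_def, Function.comp_def] using
        hp.mul (l.differentiable.comp (differentiable_exp_smul A))
    · simpa [evalGL, Pi.mul_def, Function.comp_def] using hp.mul (l.differentiable.comp hneg)

/-- A differentiable homomorphism from `ℂ` to the multiplicative monoid of `ℂ` is exponential. -/
theorem eq_exp_of_map_add {c : ℂ → ℂ} (hd : Differentiable ℂ c) (h0 : c 0 = 1)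
    (hadd : ∀ z w, c (z + w) = c z * c w) (z : ℂ) : c z = Complex.exp (z * deriv c 0) := by
  set a := deriv c 0
  -- Additivity transports the derivative at 0 to z, giving the equation c' = a c.
  have hder : ∀ z, HasDerivAt c (c z * a) z := by
    intro z
    have h1 : HasDerivAt c a (z - z) := by rw [sub_self]; exact (hd 0).hasDerivAt
    have h2 := (h1.comp_sub_const z z).const_mul (c z)
    refine h2.congr_of_eventuallyEq (Eventually.of_forall fun w => ?_)
    simp only [← hadd, add_sub_cancel]
  have hexp : ∀ z, HasDerivAt (fun z => Complex.exp (-(z * a))) (Complex.exp (-(z * a)) * -a) z :=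
    fun z => by simpa using (((hasDerivAt_id z).mul_const a).neg).cexp
  have hprod : ∀ z, HasDerivAt (fun z => c z * Complex.exp (-(z * a))) 0 z := by
    intro z
    refine ((hder z).mul (hexp z)).congr_deriv ?_
    ring
  have hconst := is_const_of_deriv_eq_zero (fun z => (hprod z).differentiableAt)
    (fun z => (hprod z).deriv) z 0
  simp only [h0, zero_mul, neg_zero, Complex.exp_zero, mul_one] at hconst
  rw [Complex.exp_neg, ← div_eq_mul_inv, div_eq_one_iff_eq (Complex.exp_ne_zero _)] at hconst
  exact hconst

/-- The function z ↦ χ(exp(zY)) is an entire homomorphism, hence exp(zD) with D = dχ(Y). At z = i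
its squared modulus is exp(2 Re(iD)); this is where the factor 2 in front of ⟨θ,Y⟩ arises. -/
theorem log_norm_character_exp (hG : IsAlgebraicGroup G) (hHG : H ≤ G)
    (hH : IsClosed (H : Set (W →L[ℂ] W)ˣ)) (χ : characterGroup G) (Y : lieAlgebra H hH)
    (hY : expGL (Complex.I • (Y : W →L[ℂ] W)) ∈ G) :
    Real.log (‖(((χ : G →* ℂˣ) ⟨expGL (Complex.I • (Y : W →L[ℂ] W)), hY⟩ : ℂˣ) : ℂ)‖ ^ 2) =
      2 * charForm hHG hH χ Y := by
  have hmem : ∀ z : ℂ, expGL (z • (Y : W →L[ℂ] W)) ∈ G :=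
    hG.expGL_smul_mem fun t => hHG (Y.2 t)
  set c : ℂ → ℂ := fun z => (((χ : G →* ℂˣ) ⟨expGL (z • (Y : W →L[ℂ] W)), hmem z⟩ : ℂˣ) : ℂ) with hc
  have hd : Differentiable ℂ c := by
    obtain ⟨P, hP⟩ := χ.2
    have h1 : c = fun z : ℂ => evalGL P (NormedSpace.exp (z • (Y : W →L[ℂ] W)))
        (NormedSpace.exp (-(z • (Y : W →L[ℂ] W)))) := by
      funext z
      exact hP ⟨expGL (z • (Y : W →L[ℂ] W)), hmem z⟩
    rw [h1]
    exact differentiable_evalGL_exp _ P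
  have hadd : ∀ z w, c (z + w) = c z * c w := by
    intro z w
    simp only [hc]
    rw [← Units.val_mul, ← map_mul]
    congr 3
    exact expGL_add_smul z w _
  have h0 : c 0 = 1 := by
    have h1 := hadd 0 0
    rw [add_zero] at h1
    exact (mul_eq_left₀ (Units.ne_zero _)).1 h1.symm
  have hderiv : charDeriv hHG hH χ Y = deriv c 0 := by
    have h1 : charExp hHG hH χ Y = fun t : ℝ => c t := by
      funext t
      simp only [charExp, hc, Complex.coe_smul]
    have h2 : HasDerivAt c (deriv c 0) ((0 : ℝ) : ℂ) := by simpa using (hd 0).hasDerivAt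
    rw [charDeriv, h1]
    exact h2.comp_ofReal.deriv
  change Real.log (‖c Complex.I‖ ^ 2) = 2 * (Complex.I * charDeriv hHG hH χ Y).re
  rw [eq_exp_of_map_add hd h0 hadd, hderiv, Complex.norm_exp, Real.log_pow, Real.log_exp]
  norm_num

theorem realCharForm_tmul (hHG : H ≤ G) (hH : IsClosed (H : Set (W →L[ℂ] W)ˣ)) (r : ℝ)
    (χ : Additive (characterGroup G)) (Y : lieAlgebra H hH) :
    realCharForm hHG hH (r ⊗ₜ[ℤ] χ) Y = r * charForm hHG hH χ.toMul Y := by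
  simp [realCharForm]

theorem logAbsSq_exp (hG : IsAlgebraicGroup G) (hHG : H ≤ G)
    (hH : IsClosed (H : Set (W →L[ℂ] W)ˣ)) (χ : RealCharacter G) (Y : lieAlgebra H hH)
    (hY : expGL (Complex.I • (Y : W →L[ℂ] W)) ∈ G) :
    logAbsSq G ⟨expGL (Complex.I • (Y : W →L[ℂ] W)), hY⟩ χ = 2 * realCharForm hHG hH χ Y := by
  induction χ using TensorProduct.induction_on with
  | zero => simp
  | tmul r χ =>
    rw [logAbsSq_tmul, realCharForm_tmul, log_norm_character_exp hG hHG hH χ.toMul Y hY]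
    ring
  | add x y hx hy =>
    refine ((logAbsSq G _).map_add x y).trans ?_
    rw [hx, hy, ← mul_add]
    exact congrArg (2 * ·) (LinearMap.congr_fun ((realCharForm hHG hH).map_add x y) Y).symm

theorem InvariantScalarProduct.form_iota {hH : IsClosed (H : Set (W →L[ℂ] W)ˣ)}
    (B : InvariantScalarProduct H hH) (hHG : H ≤ G) (χ : RealCharacter G) (Y : lieAlgebra H hH) :
    B.form (B.iota hHG χ) Y = realCharForm hHG hH χ Y := by
  have : FiniteDimensional ℝ (W →L[ℂ] W) := FiniteDimensional.complexToReal (W →L[ℂ] W)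
  exact LinearMap.BilinForm.apply_toDual_symm_apply (B := B.form) (hB := B.nondegenerate) _ _

end Characters

/-! ### Behaviour of `exp(tA)v` along rays. -/

section Rays

variable {W : Type*} [NormedAddCommGroup W] [InnerProductSpace ℂ W] [FiniteDimensional ℂ W]
  [CompleteSpace W]

/-- A sum of functions exp(2tμᵢ) with nonnegative coefficients |⟨bᵢ,v⟩|². -/
theorem convexOn_norm_exp_smul_sq {A : W →L[ℂ] W} (hA : IsSelfAdjoint A) (v : W) :
    ConvexOn ℝ Set.univ fun t : ℝ => ‖NormedSpace.exp (t • A) v‖ ^ 2 := by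
  obtain ⟨b, μ, hb⟩ := exists_eigenbasis hA
  simp only [norm_exp_smul_apply_sq hb]
  have hterm : ∀ i, ConvexOn ℝ Set.univ
      fun t : ℝ => Real.exp (2 * t * μ i) * ‖⟪b i, v⟫_ℂ‖ ^ 2 := by
    intro i
    have h1 : ConvexOn ℝ Set.univ fun t : ℝ => Real.exp (2 * t * μ i) := by
      have h2 := convexOn_exp.comp_linearMap (LinearMap.mulLeft ℝ (2 * μ i))
      rw [Set.preimage_univ] at h2
      refine h2.congr fun t _ => ?_
      simp only [Function.comp, LinearMap.mulLeft_apply]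
      ring_nf
    have h3 := h1.smul (sq_nonneg ‖⟪b i, v⟫_ℂ‖)
    simpa [mul_comm] using h3
  induction (Finset.univ : Finset (Fin (Module.finrank ℂ W))) using Finset.induction_on with
  | empty => simpa using convexOn_const (0 : ℝ) convex_univ
  | insert i s hi ih =>
    simp only [Finset.sum_insert hi]
    exact (hterm i).add ih

/-- Along a ray, `exp (t A) v` either converges or grows exponentially. -/
theorem tendsto_or_le_norm_exp_smul {A : W →L[ℂ] W} (hA : IsSelfAdjoint A) (v : W) :
    (∃ y, Tendsto (fun t : ℝ => NormedSpace.exp (t • A) v) atTop (𝓝 y)) ∨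
      ∃ μ > 0, ∃ c > 0, ∀ t : ℝ, c * Real.exp (2 * t * μ) ≤ ‖NormedSpace.exp (t • A) v‖ ^ 2 := by
  obtain ⟨b, μ, hb⟩ := exists_eigenbasis hA
  -- The alternative is whether v has a component along an eigenvector with positive eigenvalue.
  by_cases h : ∃ i, 0 < μ i ∧ ⟪b i, v⟫_ℂ ≠ 0
  · obtain ⟨i, hi, hv⟩ := h
    refine Or.inr ⟨μ i, hi, ‖⟪b i, v⟫_ℂ‖ ^ 2, by positivity, fun t => ?_⟩
    rw [norm_exp_smul_apply_sq hb, mul_comm]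
    exact Finset.single_le_sum
      (f := fun i => Real.exp (2 * t * μ i) * ‖⟪b i, v⟫_ℂ‖ ^ 2)
      (fun i _ => by positivity) (Finset.mem_univ i)
  · left
    push Not at h
    have h1 : ∀ i, ∃ c : ℂ, Tendsto (fun t : ℝ => Complex.exp (t * μ i) * ⟪b i, v⟫_ℂ) atTop (𝓝 c) := by
      intro i
      rcases lt_trichotomy (μ i) 0 with hi | hi | hi
      · refine ⟨0, ?_⟩
        have h2 : Tendsto (fun t : ℝ => ((Real.exp (t * μ i) : ℝ) : ℂ)) atTop (𝓝 ((0 : ℝ) : ℂ)) :=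
          (Complex.continuous_ofReal.tendsto 0).comp
            (Real.tendsto_exp_atBot.comp (tendsto_id.atTop_mul_const_of_neg hi))
        have h3 := h2.mul_const ⟪b i, v⟫_ℂ
        simpa using h3
      · refine ⟨⟪b i, v⟫_ℂ, ?_⟩
        simp [hi]
      · refine ⟨0, ?_⟩
        simp [h i hi]
    choose c hc using h1
    refine ⟨∑ i, c i • b i, ?_⟩
    have h2 : ∀ t : ℝ, NormedSpace.exp (t • A) v =
        ∑ i, (Complex.exp (t * μ i) * ⟪b i, v⟫_ℂ) • b i := by
      intro t
      rw [← Complex.coe_smul, exp_smul_apply_eq_sum hb]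
    simp only [h2]
    exact tendsto_finsetSum _ fun i _ => (hc i).smul_const _

/-- A nonzero real eigenvalue makes exp(tA) unbounded in one direction of t: at t = C/μᵢ its norm is
at least exp C > C. -/
theorem eq_zero_of_norm_exp_smul_le {A : W →L[ℂ] W} (hA : IsSelfAdjoint A) {C : ℝ}
    (h : ∀ t : ℝ, ‖NormedSpace.exp (t • A)‖ ≤ C) : A = 0 := by
  obtain ⟨b, μ, hb⟩ := exists_eigenbasis hA
  have hμ : ∀ i, μ i = 0 := by
    intro i
    by_contra hi
    have h1 : ‖NormedSpace.exp ((C / μ i) • A) (b i)‖ = Real.exp C := by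
      rw [← Complex.coe_smul, exp_smul_apply_eigen (hb i), norm_smul, b.orthonormal.1 i, mul_one,
        ← Complex.ofReal_mul, div_mul_cancel₀ _ hi, ← Complex.ofReal_exp]
      simp
    have h2 := (NormedSpace.exp ((C / μ i) • A)).le_of_opNorm_le (h _) (b i)
    rw [h1, b.orthonormal.1 i, mul_one] at h2
    linarith [Real.add_one_le_exp C]
  ext v
  rw [← b.sum_repr' v]
  simp [hb, hμ]

end Rays

/-! ### Growth of the Kempf-Ness function in a group with polar decomposition. -/

/-- A group acting linearly on a hermitian space, with a polar decomposition into the exponential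
of a space of self-adjoint endomorphisms and a compact set of isometries, together with an additive
function on the group. -/
structure PolarRep (Γ V W : Type*) [Group Γ] [NormedAddCommGroup V] [NormedSpace ℝ V]
    [NormedAddCommGroup W] [InnerProductSpace ℂ W] [CompleteSpace W] where
  /-- the action -/
  ρ : Γ →* (W →L[ℂ] W)
  /-- the self-adjoint infinitesimal generators -/
  gen : V →ₗ[ℝ] (W →L[ℂ] W)
  /-- the exponential map -/
  e : V → Γ
  /-- the additive function -/
  L : Γ → ℝ
  /-- the restriction of half of the additive function to the infinitesimal generators -/
  ell : V →ₗ[ℝ] ℝ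
  /-- the isometric elements -/
  U : Set Γ
  gen_selfAdjoint : ∀ Y, IsSelfAdjoint (gen Y)
  gen_injective : ∀ Y, gen Y = 0 → Y = 0
  ρ_e : ∀ Y, ρ (e Y) = NormedSpace.exp (gen Y)
  L_mul : ∀ γ γ', L (γ * γ') = L γ + L γ'
  L_U : ∀ u ∈ U, L u = 0
  L_e : ∀ Y, L (e Y) = 2 * ell Y
  norm_U : ∀ u ∈ U, ∀ v, ‖ρ u v‖ = ‖v‖
  isCompact_U : IsCompact (ρ '' U)
  exists_polar : ∀ γ, ∃ u ∈ U, ∃ Y, γ = u * e Y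
  exists_inv : ∀ u ∈ U, ∀ Y, ∃ u' ∈ U, ∃ Y', ‖Y'‖ ≤ ‖Y‖ ∧ (u * e Y)⁻¹ = u' * e Y'

namespace PolarRep

variable {Γ V W : Type*} [Group Γ] [NormedAddCommGroup V] [NormedSpace ℝ V]
  [FiniteDimensional ℝ V] [NormedAddCommGroup W] [InnerProductSpace ℂ W] [FiniteDimensional ℂ W]
  [CompleteSpace W] (P : PolarRep Γ V W)

/-- The Kempf-Ness function on the infinitesimal generators. -/
noncomputable def energy (v : W) (Y : V) : ℝ := ‖NormedSpace.exp (P.gen Y) v‖ ^ 2 - 2 * P.ell Y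

/-- The Kempf-Ness function on the group. -/
noncomputable def phi (v : W) (γ : Γ) : ℝ := ‖P.ρ γ v‖ ^ 2 - P.L γ

theorem continuous_gen : Continuous P.gen := P.gen.continuous_of_finiteDimensional

theorem continuous_exp_gen_apply :
    Continuous fun p : W × V => NormedSpace.exp (P.gen p.2) p.1 :=
  (continuous_exp_endo.comp (P.continuous_gen.comp continuous_snd)).clm_apply continuous_fst

theorem continuous_energy : Continuous fun p : W × V => P.energy p.1 p.2 :=
  (P.continuous_exp_gen_apply.norm.pow 2).sub
    (continuous_const.mul (P.ell.continuous_of_finiteDimensional.comp continuous_snd))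

theorem energy_zero (v : W) : P.energy v 0 = ‖v‖ ^ 2 := by simp [energy]

theorem neg_two_mul_le_energy (v : W) (Y : V) : -(2 * P.ell Y) ≤ P.energy v Y := by
  have := sq_nonneg ‖NormedSpace.exp (P.gen Y) v‖
  rw [energy]
  linarith

/-- Convexity on the ray: the chord slope from 0 to t is at most the one from 0 to s. -/
theorem energy_ray (v : W) (Y : V) {s t : ℝ} (ht : 0 < t) (hts : t ≤ s) :
    P.energy v 0 + s / t * (P.energy v (t • Y) - P.energy v 0) ≤ P.energy v (s • Y) := by
  have hs : 0 < s := ht.trans_le hts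
  have hw1 : 0 ≤ 1 - t / s := sub_nonneg.2 ((div_le_one hs).2 hts)
  have hw2 : 0 ≤ t / s := by positivity
  have hconv := (convexOn_norm_exp_smul_sq (P.gen_selfAdjoint Y) v).2 (Set.mem_univ (0 : ℝ))
    (Set.mem_univ s) hw1 hw2 (sub_add_cancel _ _)
  have h1 : (1 - t / s) • (0 : ℝ) + (t / s) • s = t := by
    simp [div_mul_cancel₀ _ hs.ne']
  rw [h1] at hconv
  simp only [smul_eq_mul, zero_smul, NormedSpace.exp_zero, one_apply_eq_self] at hconv
  simp only [energy, map_smul, map_zero, smul_eq_mul, NormedSpace.exp_zero, one_apply_eq_self]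
  have h2 := mul_le_mul_of_nonneg_left hconv (by positivity : 0 ≤ s / t)
  have h3 : s / t * ((1 - t / s) * ‖v‖ ^ 2 + t / s * ‖NormedSpace.exp (s • P.gen Y) v‖ ^ 2) =
      (s / t - 1) * ‖v‖ ^ 2 + ‖NormedSpace.exp (s • P.gen Y) v‖ ^ 2 := by
    field_simp
  have h4 : s / t * (2 * (t * P.ell Y)) = 2 * (s * P.ell Y) := by field_simp
  linarith

/-- If the Kempf-Ness function increases along every ray, then it has linear growth. -/
theorem exists_growth {v : W} (h : ∀ Y : V, Y ≠ 0 → ∃ t > (0 : ℝ), P.energy v 0 < P.energy v (t • Y)) :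
    ∃ a > 0, ∃ b : ℝ, ∀ Y, a * ‖Y‖ - b ≤ P.energy v Y := by
  have hproper : ProperSpace V := FiniteDimensional.proper ℝ V
  have key : ∃ a > 0, ∃ N > 0, ∀ u ∈ Metric.sphere (0 : V) 1, ∀ s ≥ N,
      P.energy v 0 + a * s ≤ P.energy v (s • u) := by
    refine (isCompact_sphere (0 : V) 1).induction_on (p := fun S => ∃ a > (0 : ℝ), ∃ N > (0 : ℝ),
      ∀ u ∈ S, ∀ s ≥ N, P.energy v 0 + a * s ≤ P.energy v (s • u)) ?_ ?_ ?_ ?_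
    · exact ⟨1, one_pos, 1, one_pos, by simp⟩
    · rintro S T hST ⟨a, ha, N, hN, H⟩
      exact ⟨a, ha, N, hN, fun u hu => H u (hST hu)⟩
    · rintro S T ⟨a, ha, N, hN, H⟩ ⟨a', ha', N', hN', H'⟩
      refine ⟨min a a', lt_min ha ha', max N N', lt_max_of_lt_left hN, ?_⟩
      intro u hu s hs
      have hs0 : 0 ≤ s := (hN.trans_le ((le_max_left _ _).trans hs)).le
      rcases hu with hu | hu
      · have h1 := H u hu s ((le_max_left _ _).trans hs)
        have h2 := mul_le_mul_of_nonneg_right (min_le_left a a') hs0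
        linarith
      · have h1 := H' u hu s ((le_max_right _ _).trans hs)
        have h2 := mul_le_mul_of_nonneg_right (min_le_right a a') hs0
        linarith
    · intro u hu
      have hu0 : u ≠ 0 := by
        rintro rfl
        simp at hu
      obtain ⟨t, ht, hlt⟩ := h u hu0
      -- The intermediate value m makes the strict inequality at time t hold on a neighbourhood of u
      -- with a uniform gap.
      obtain ⟨m, hm0, hm⟩ := exists_between hlt
      have hcont : Continuous fun w : V => P.energy v (t • w) :=
        P.continuous_energy.comp (continuous_const.prodMk (continuous_const_smul t))
      refine ⟨{w | m < P.energy v (t • w)}, mem_nhdsWithin_of_mem_nhds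
        ((isOpen_lt continuous_const hcont).mem_nhds hm), (m - P.energy v 0) / t,
        div_pos (sub_pos.2 hm0) ht, t, ht, fun w hw s hs => ?_⟩
      refine le_trans ?_ (P.energy_ray v w ht hs)
      have h1 : (m - P.energy v 0) / t * s = s / t * (m - P.energy v 0) := by ring
      have h2 : 0 ≤ s / t := div_nonneg (ht.le.trans hs) ht.le
      rw [h1]
      have hw' : m < P.energy v (t • w) := hw
      gcongr
  obtain ⟨a, ha, N, hN, H⟩ := key
  set l := LinearMap.toContinuousLinearMap P.ell with hl
  -- For ‖Y‖ < N the crude bound −2‖l‖N is absorbed in the constant.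
  refine ⟨a, ha, a * N + 2 * (‖l‖ * N), fun Y => ?_⟩
  rcases le_or_gt N ‖Y‖ with hY | hY
  · have hY0 : 0 < ‖Y‖ := hN.trans_le hY
    have h1 := H (‖Y‖⁻¹ • Y) (by simp [norm_smul, hY0.ne']) ‖Y‖ hY
    rw [smul_smul, mul_inv_cancel₀ hY0.ne', one_smul, P.energy_zero] at h1
    have : 0 ≤ ‖l‖ * N := by positivity
    nlinarith [sq_nonneg ‖v‖]
  · have h1 := P.neg_two_mul_le_energy v Y
    have h2 : P.ell Y ≤ ‖l‖ * ‖Y‖ := (le_abs_self _).trans (l.le_opNorm Y)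
    have h3 : ‖l‖ * ‖Y‖ ≤ ‖l‖ * N := mul_le_mul_of_nonneg_left hY.le (norm_nonneg _)
    have h4 : a * ‖Y‖ ≤ a * N := mul_le_mul_of_nonneg_left hY.le ha.le
    linarith

/-- Near a point where the Kempf-Ness function has a minimum at the identity, the slope at infinity
of the Kempf-Ness function is almost nonnegative. -/
theorem eventually_le_energy {z : W} (hz : ∀ Y, P.energy z 0 ≤ P.energy z Y) {ε : ℝ}
    (hε : 0 < ε) : ∀ᶠ y in 𝓝 z, ∀ Y, ‖y‖ ^ 2 - ε * (1 + ‖Y‖) ≤ P.energy y Y := by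
  have hproper : ProperSpace V := FiniteDimensional.proper ℝ V
  have h1 : ∀ᶠ y in 𝓝 z, ∀ Y ∈ Metric.closedBall (0 : V) 1, P.energy y 0 - ε < P.energy y Y := by
    refine (isCompact_closedBall (0 : V) 1).eventually_forall_of_forall_eventually fun Y _ => ?_
    refine (isOpen_lt ?_ P.continuous_energy).mem_nhds ?_
    · exact (P.continuous_energy.comp (continuous_fst.prodMk continuous_const)).sub continuous_const
    · have := hz Y
      simp only [Set.mem_ofPred_eq]
      linarith
  filter_upwards [h1] with y hy Y
  rw [← P.energy_zero y]
  rcases le_or_gt ‖Y‖ 1 with hY | hY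
  · have h2 := hy Y (by simpa using hY)
    nlinarith [norm_nonneg Y]
  · have hY0 : 0 < ‖Y‖ := one_pos.trans hY
    have h2 := hy (‖Y‖⁻¹ • Y) (by simp [norm_smul, hY0.ne'])
    -- Uniform control on the unit ball propagates outwards: the slope between times 0 and 1 exceeds
    -- −ε, hence so does the slope up to ‖Y‖.
    have h3 := P.energy_ray y (‖Y‖⁻¹ • Y) one_pos hY.le
    rw [one_smul, smul_smul, mul_inv_cancel₀ hY0.ne', one_smul, div_one] at h3
    nlinarith

theorem phi_polar (v : W) {u : Γ} (hu : u ∈ P.U) (Y : V) : P.phi v (u * P.e Y) = P.energy v Y := by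
  rw [phi, energy, map_mul, mul_apply_eq_comp, P.norm_U u hu, P.ρ_e, P.L_mul, P.L_U u hu, P.L_e,
    zero_add]

theorem L_one : P.L 1 = 0 := by
  have h := P.L_mul 1 1
  rw [mul_one] at h
  linarith

/-- Moving the base point along the orbit translates the Kempf-Ness function on the right, up to an
additive constant. -/
theorem phi_apply (v : W) (γ γ' : Γ) : P.phi (P.ρ γ v) γ' = P.phi v (γ' * γ) + P.L γ := by
  rw [phi, phi, map_mul, mul_apply_eq_comp, P.L_mul]
  ring

theorem phi_one (v : W) : P.phi v 1 = ‖v‖ ^ 2 := by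
  rw [phi, map_one, one_apply_eq_self, P.L_one, sub_zero]

theorem energy_zero_le_iff {z : W} :
    (∀ Y, P.energy z 0 ≤ P.energy z Y) ↔ ∀ γ, P.phi z 1 ≤ P.phi z γ := by
  rw [P.energy_zero, P.phi_one]
  constructor
  · intro h γ
    obtain ⟨u, hu, Y, rfl⟩ := P.exists_polar γ
    rw [P.phi_polar z hu]
    exact h Y
  · intro h Y
    obtain ⟨u, hu, -⟩ := P.exists_polar 1
    rw [← P.phi_polar z hu]
    exact h _

/-- The elements of the group the self-adjoint part of which has norm at most `R`. -/
def ball (R : ℝ) : Set Γ := {γ | ∃ u ∈ P.U, ∃ Y, ‖Y‖ ≤ R ∧ γ = u * P.e Y}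

theorem isCompact_image_ball (R : ℝ) (v : W) : IsCompact ((fun γ => P.ρ γ v) '' P.ball R) := by
  have hproper : ProperSpace V := FiniteDimensional.proper ℝ V
  have h1 := (P.isCompact_U.prod (isCompact_closedBall (0 : V) R)).image
    (f := fun p : (W →L[ℂ] W) × V => p.1 (NormedSpace.exp (P.gen p.2) v))
    (continuous_fst.clm_apply (P.continuous_exp_gen_apply.comp
      (continuous_const.prodMk continuous_snd)))
  convert h1 using 1
  ext w
  constructor
  · rintro ⟨_, ⟨u, hu, Y, hY, rfl⟩, rfl⟩
    refine ⟨(P.ρ u, Y), ⟨⟨u, hu, rfl⟩, by simpa using hY⟩, ?_⟩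
    simp [P.ρ_e]
  · rintro ⟨⟨_, Y⟩, ⟨⟨u, hu, rfl⟩, hY⟩, rfl⟩
    refine ⟨_, ⟨u, hu, Y, by simpa using hY, rfl⟩, ?_⟩
    simp [P.ρ_e]

/-- Inverses stay in the same ball by `exists_inv`, so a bound for the elements also serves for
their inverses. -/
theorem exists_norm_le_of_mem_ball (R : ℝ) :
    ∃ C, 0 ≤ C ∧ ∀ γ ∈ P.ball R, ‖P.ρ γ‖ ≤ C ∧ ‖P.ρ γ⁻¹‖ ≤ C := by
  have hproper : ProperSpace V := FiniteDimensional.proper ℝ V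
  obtain ⟨C, hC⟩ := (isCompact_closedBall (0 : V) R).exists_bound_of_continuousOn
    (continuous_exp_endo.comp P.continuous_gen).continuousOn
  have h1 : ∀ γ ∈ P.ball R, ‖P.ρ γ‖ ≤ max C 0 := by
    rintro _ ⟨u, hu, Y, hY, rfl⟩
    refine ContinuousLinearMap.opNorm_le_bound _ (le_max_right _ _) fun v => ?_
    rw [map_mul, mul_apply_eq_comp, P.norm_U u hu, P.ρ_e]
    refine (ContinuousLinearMap.le_opNorm _ v).trans (mul_le_mul_of_nonneg_right ?_ (norm_nonneg _))
    exact (hC Y (by simpa using hY)).trans (le_max_left _ _)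
  refine ⟨max C 0, le_max_right _ _, fun γ hγ => ⟨h1 γ hγ, h1 _ ?_⟩⟩
  obtain ⟨u, hu, Y, hY, rfl⟩ := hγ
  obtain ⟨u', hu', Y', hY', h⟩ := P.exists_inv u hu Y
  exact ⟨u', hu', Y', hY'.trans hY, h⟩

/-- If the Kempf-Ness function of `x` has linear growth, then the group elements sending `x` close
to a point with minimal Kempf-Ness function are bounded. -/
theorem exists_eventually_mem_ball {x z : W} {a b : ℝ} (ha : 0 < a)
    (hx : ∀ Y, a * ‖Y‖ - b ≤ P.energy x Y) (hz : ∀ Y, P.energy z 0 ≤ P.energy z Y) :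
    ∃ R, ∀ᶠ y in 𝓝 z, ∀ γ, P.ρ γ x = y → γ ∈ P.ball R := by
  -- Add the growth estimate for x at γ and the slope estimate with ε = a/2 for y = γx at γ⁻¹. The
  -- terms ‖y‖² and `L γ` cancel, leaving (a/2)‖Y‖ ≤ b + ‖x‖² + a/2.
  refine ⟨2 * (b + ‖x‖ ^ 2 + a / 2) / a, ?_⟩
  filter_upwards [P.eventually_le_energy hz (half_pos ha)] with y hy γ hγ
  obtain ⟨u, hu, Y, rfl⟩ := P.exists_polar γ
  obtain ⟨u', hu', Y', hY', hinv⟩ := P.exists_inv u hu Y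
  refine ⟨u, hu, Y, ?_, rfl⟩
  have h1 := hx Y
  rw [← P.phi_polar x hu, phi, hγ] at h1
  have h2 := hy Y'
  rw [← P.phi_polar y hu', ← hinv, ← hγ, P.phi_apply, inv_mul_cancel, P.phi_one, hγ] at h2
  rw [le_div_iff₀ ha]
  nlinarith

/-- Some k moves y into the neighbourhood of z where group elements are controlled. Points of the
orbit of x near y then lie in k⁻¹ applied to a compact piece of that orbit, which is closed and so
contains y. -/
theorem mem_orbit_of_mem_closure {x y z : W} {a b : ℝ} (ha : 0 < a)
    (hx : ∀ Y, a * ‖Y‖ - b ≤ P.energy x Y) (hz : ∀ Y, P.energy z 0 ≤ P.energy z Y)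
    (hzy : z ∈ closure (Set.range fun γ => P.ρ γ y))
    (hyx : y ∈ closure (Set.range fun γ => P.ρ γ x)) : y ∈ Set.range fun γ => P.ρ γ x := by
  obtain ⟨R, hR⟩ := P.exists_eventually_mem_ball ha hx hz
  obtain ⟨O, hO, hOopen, hzO⟩ := eventually_nhds_iff.1 hR
  obtain ⟨_, hkO, k, rfl⟩ := mem_closure_iff.1 hzy O hOopen hzO
  set S : Set W := P.ρ k⁻¹ '' ((fun γ => P.ρ γ x) '' P.ball R) with hS
  have hSc : IsClosed S := ((P.isCompact_image_ball R x).image (P.ρ k⁻¹).continuous).isClosed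
  have hSx : S ⊆ Set.range fun γ => P.ρ γ x := by
    rintro _ ⟨_, ⟨γ, -, rfl⟩, rfl⟩
    exact ⟨k⁻¹ * γ, by simp⟩
  refine hSx ?_
  rw [← hSc.closure_eq]
  refine mem_closure_iff.2 fun N hN hyN => ?_
  obtain ⟨_, ⟨hwN, hwO⟩, γ, rfl⟩ := mem_closure_iff.1 hyx (N ∩ P.ρ k ⁻¹' O)
    (hN.inter (hOopen.preimage (P.ρ k).continuous)) ⟨hyN, hkO⟩
  refine ⟨_, hwN, _, ⟨k * γ, hO _ hwO (k * γ) (by simp), rfl⟩, ?_⟩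
  rw [← mul_apply_eq_comp, ← map_mul, inv_mul_cancel_left]

theorem exists_phi_min {x : W} {a b : ℝ} (ha : 0 < a)
    (hx : ∀ Y, a * ‖Y‖ - b ≤ P.energy x Y) : ∃ γ, ∀ γ', P.phi x γ ≤ P.phi x γ' := by
  have hproper : ProperSpace V := FiniteDimensional.proper ℝ V
  have hcont : Continuous (P.energy x) :=
    P.continuous_energy.comp (continuous_const.prodMk continuous_id)
  have htend : Tendsto (P.energy x) (cocompact V) atTop := by
    refine tendsto_atTop_mono hx ?_
    exact tendsto_atTop_add_const_right _ _ ((tendsto_norm_cocompact_atTop (E := V)).const_mul_atTop ha)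
  obtain ⟨Y, hY⟩ := hcont.exists_forall_le htend
  obtain ⟨u, hu, -⟩ := P.exists_polar 1
  refine ⟨u * P.e Y, fun γ' => ?_⟩
  obtain ⟨u', hu', Y', rfl⟩ := P.exists_polar γ'
  rw [P.phi_polar x hu, P.phi_polar x hu']
  exact hY Y'

theorem phi_one_le_of_min {x : W} {γ : Γ} (h : ∀ γ', P.phi x γ ≤ P.phi x γ') (γ' : Γ) :
    P.phi (P.ρ γ x) 1 ≤ P.phi (P.ρ γ x) γ' := by
  rw [P.phi_apply, P.phi_apply, one_mul]
  linarith [h (γ' * γ)]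

/-- If γ₀x is minimal and γ fixes x, then γ₀γ also sends x to γ₀x, so it stays in a fixed ball. -/
theorem exists_norm_stabilizer_le {x : W} {a b : ℝ} (ha : 0 < a)
    (hx : ∀ Y, a * ‖Y‖ - b ≤ P.energy x Y) : ∃ C, ∀ γ, P.ρ γ x = x → ‖P.ρ γ‖ ≤ C := by
  obtain ⟨γ₀, hγ₀⟩ := P.exists_phi_min ha hx
  obtain ⟨R, hR⟩ := P.exists_eventually_mem_ball ha hx
    (P.energy_zero_le_iff.2 (P.phi_one_le_of_min hγ₀))
  obtain ⟨C, hC0, hC⟩ := P.exists_norm_le_of_mem_ball R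
  refine ⟨‖P.ρ γ₀⁻¹‖ * C, fun γ hγ => ?_⟩
  have h1 := hC _ (hR.self_of_nhds (γ₀ * γ) (by simp [hγ]))
  have h2 : γ = γ₀⁻¹ * (γ₀ * γ) := by group
  rw [h2, map_mul]
  exact (norm_mul_le _ _).trans (mul_le_mul_of_nonneg_left h1.1 (norm_nonneg _))

/-- If the minimum were attained again at Y, the midpoint identity would force exp(`gen Y`) to fix
z. The minimum is therefore strict, and convexity gives growth. -/
theorem exists_growth_of_min {z : W} (hz : ∀ Y, P.energy z 0 ≤ P.energy z Y)
    (hstab : ∀ Y, NormedSpace.exp (P.gen Y) z = z → Y = 0) :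
    ∃ a > 0, ∃ b : ℝ, ∀ Y, a * ‖Y‖ - b ≤ P.energy z Y := by
  refine P.exists_growth fun Y hY => ⟨1, one_pos, ?_⟩
  rw [one_smul]
  refine lt_of_le_of_ne (hz Y) fun heq => hY (hstab Y ?_)
  have h1 := norm_exp_apply_sub_sq (P.gen_selfAdjoint Y) z
  have h2 := hz ((1 / 2 : ℝ) • Y)
  rw [P.energy_zero, energy, map_smul, map_smul, smul_eq_mul] at h2
  rw [P.energy_zero, energy] at heq
  have h3 : ‖NormedSpace.exp (P.gen Y) z - z‖ ^ 2 = 0 := by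
    refine le_antisymm ?_ (sq_nonneg _)
    rw [h1]
    linarith
  rwa [sq_eq_zero_iff, norm_eq_zero, sub_eq_zero] at h3

/-- If the Kempf-Ness function of a point in the orbit of `x` has linear growth, then `ell` is
negative on the generators of the rays along which the orbit of `x` remains bounded. -/
theorem ell_neg_of_growth {x : W} {g : Γ} {a b : ℝ} (ha : 0 < a)
    (hz : ∀ Y, a * ‖Y‖ - b ≤ P.energy (P.ρ g x) Y) {Y : V} (hY : Y ≠ 0) {M : ℝ}
    (hM : ∀ t : ℝ, 0 ≤ t → ‖NormedSpace.exp (t • P.gen Y) x‖ ^ 2 ≤ M) : P.ell Y < 0 := by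
  by_contra! hell
  obtain ⟨C, hC0, hC⟩ := P.exists_norm_le_of_mem_ball ((M + P.L g + b) / a)
  -- With `ell Y` ≥ 0 the Kempf-Ness function of gx at e(tY)g⁻¹ is at most M + L(g), so growth
  -- bounds the polar part uniformly in t.
  have hball : ∀ t : ℝ, 0 ≤ t → P.e (t • Y) * g⁻¹ ∈ P.ball ((M + P.L g + b) / a) := by
    intro t ht
    obtain ⟨u, hu, Z, hZ⟩ := P.exists_polar (P.e (t • Y) * g⁻¹)
    refine ⟨u, hu, Z, ?_, hZ⟩
    have h1 := hz Z
    rw [← P.phi_polar _ hu, ← hZ, P.phi_apply, inv_mul_cancel_right, phi, P.ρ_e, P.L_e, map_smul,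
      map_smul, smul_eq_mul] at h1
    have h2 := hM t ht
    rw [le_div_iff₀ ha]
    nlinarith [mul_nonneg ht hell]
  have hpos : ∀ t : ℝ, 0 ≤ t → ‖NormedSpace.exp (t • P.gen Y)‖ ≤ C * ‖P.ρ g‖ ∧
      ‖NormedSpace.exp (-t • P.gen Y)‖ ≤ ‖P.ρ g⁻¹‖ * C := by
    intro t ht
    obtain ⟨h1, h2⟩ := hC _ (hball t ht)
    have h3 : P.ρ (P.e (t • Y)) = P.ρ (P.e (t • Y) * g⁻¹) * P.ρ g := by
      rw [← map_mul, inv_mul_cancel_right]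
    have h4 : P.ρ (P.e (t • Y))⁻¹ = P.ρ g⁻¹ * P.ρ (P.e (t • Y) * g⁻¹)⁻¹ := by
      rw [← map_mul]; congr 1; group
    have h5 : NormedSpace.exp (-t • P.gen Y) = P.ρ (P.e (t • Y))⁻¹ := by
      have h6 : P.ρ (P.e (t • Y)) * P.ρ (P.e (t • Y))⁻¹ = 1 := by
        rw [← map_mul, mul_inv_cancel, map_one]
      have h7 := exp_mul_exp_neg (-t • P.gen Y)
      rw [neg_smul, neg_neg, ← map_smul, ← P.ρ_e] at h7
      rw [neg_smul, ← map_smul]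
      exact left_inv_eq_right_inv h7 h6
    constructor
    · rw [← map_smul, ← P.ρ_e, h3]
      exact (norm_mul_le _ _).trans (mul_le_mul_of_nonneg_right h1 (norm_nonneg _))
    · rw [h5, h4]
      exact (norm_mul_le _ _).trans (mul_le_mul_of_nonneg_left h2 (norm_nonneg _))
  refine hY (P.gen_injective Y (eq_zero_of_norm_exp_smul_le (P.gen_selfAdjoint Y)
    (C := max (C * ‖P.ρ g‖) (‖P.ρ g⁻¹‖ * C)) fun t => ?_))
  rcases le_total 0 t with ht | ht
  · exact (hpos t ht).1.trans (le_max_left _ _)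
  · have h := (hpos (-t) (neg_nonneg.2 ht)).2
    rw [neg_neg] at h
    exact h.trans (le_max_right _ _)

theorem exists_energy_lt_of_ray {x : W} {Y : V}
    (h : (∃ y, Tendsto (fun t : ℝ => NormedSpace.exp (t • P.gen Y) x) atTop (𝓝 y)) →
      P.ell Y < 0) : ∃ t > (0 : ℝ), P.energy x 0 < P.energy x (t • Y) := by
  rw [P.energy_zero]
  rcases tendsto_or_le_norm_exp_smul (P.gen_selfAdjoint Y) x with hlim | ⟨μ, hμ, c, hc, hle⟩
  · have hneg := h hlim
    -- At this time the linear term alone contributes 2(‖x‖² + 1).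
    refine ⟨(‖x‖ ^ 2 + 1) / -P.ell Y, div_pos (by positivity) (neg_pos.2 hneg), ?_⟩
    have h1 := P.neg_two_mul_le_energy x (((‖x‖ ^ 2 + 1) / -P.ell Y) • Y)
    have h2 : P.ell (((‖x‖ ^ 2 + 1) / -P.ell Y) • Y) = -(‖x‖ ^ 2 + 1) := by
      rw [map_smul, smul_eq_mul]
      have := hneg.ne
      field_simp
    rw [h2] at h1
    nlinarith [sq_nonneg ‖x‖]
  · have hk : 0 < c * μ ^ 2 := by positivity
    -- Since exp(s) ≥ s²/2 for s ≥ 0, the energy is at least 2t(cμ²t − `ell Y`); this t makes the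
    -- bracket at least ‖x‖² + 1.
    set t := (|P.ell Y| + ‖x‖ ^ 2 + 1) / (c * μ ^ 2) + 1 with ht
    have ht1 : 1 ≤ t := by
      have : 0 ≤ (|P.ell Y| + ‖x‖ ^ 2 + 1) / (c * μ ^ 2) := by positivity
      linarith
    have hkt : |P.ell Y| + ‖x‖ ^ 2 + 1 ≤ c * μ ^ 2 * t := by
      rw [ht, mul_add, mul_div_cancel₀ _ hk.ne']
      linarith
    refine ⟨t, by linarith, ?_⟩
    have h1 := Real.quadratic_le_exp_of_nonneg (x := 2 * t * μ) (by positivity)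
    have h2 : c * (2 * t * μ) ^ 2 / 2 ≤ ‖NormedSpace.exp (t • P.gen Y) x‖ ^ 2 := by
      refine le_trans ?_ (hle t)
      have h3 : (2 * t * μ) ^ 2 / 2 ≤ Real.exp (2 * t * μ) := by
        have : 0 ≤ 2 * t * μ := by positivity
        linarith
      rw [mul_div_assoc]
      exact mul_le_mul_of_nonneg_left h3 hc.le
    rw [energy, map_smul, map_smul, smul_eq_mul]
    have h4 : t * (‖x‖ ^ 2 + 1) ≤ t * (c * μ ^ 2 * t - P.ell Y) := by
      refine mul_le_mul_of_nonneg_left ?_ (by linarith)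
      linarith [le_abs_self (P.ell Y)]
    have h5 : c * (2 * t * μ) ^ 2 / 2 = 2 * (t * (c * μ ^ 2 * t)) := by ring
    nlinarith [sq_nonneg ‖x‖]

end PolarRep

/-! ### Application to reductive groups, and the criterion. -/

section Main

variable {W : Type*} [NormedAddCommGroup W] [InnerProductSpace ℂ W] [FiniteDimensional ℂ W]

theorem star_mul_self_of_inner_eq [CompleteSpace W] {T : W →L[ℂ] W}
    (h : ∀ u v : W, ⟪T u, T v⟫_ℂ = ⟪u, v⟫_ℂ) : star T * T = 1 := by
  ext v
  refine ext_inner_left ℂ fun u => ?_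
  rw [mul_apply_eq_comp, ContinuousLinearMap.star_eq_adjoint,
    ContinuousLinearMap.adjoint_inner_right, h, one_apply_eq_self]

/-- The multiplication by `i`, on the Lie algebra of a closed subgroup. -/
noncomputable def iSMul (H : Subgroup (W →L[ℂ] W)ˣ) (hH : IsClosed (H : Set (W →L[ℂ] W)ˣ)) :
    lieAlgebra H hH →ₗ[ℝ] (W →L[ℂ] W) where
  toFun Y := Complex.I • (Y : W →L[ℂ] W)
  map_add' Y Z := by simp
  map_smul' c Y := by
    simp only [Submodule.coe_smul, RingHom.id_apply]
    exact smul_comm _ _ _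

theorem iSMul_apply (H : Subgroup (W →L[ℂ] W)ˣ) (hH : IsClosed (H : Set (W →L[ℂ] W)ˣ))
    (Y : lieAlgebra H hH) : iSMul H hH Y = Complex.I • (Y : W →L[ℂ] W) := rfl

theorem norm_conj_le [CompleteSpace W] {u : (W →L[ℂ] W)ˣ}
    (hu : star (u : W →L[ℂ] W) * (u : W →L[ℂ] W) = 1)
    (hu' : star ((u⁻¹ : (W →L[ℂ] W)ˣ) : W →L[ℂ] W) * ((u⁻¹ : (W →L[ℂ] W)ˣ) : W →L[ℂ] W) = 1)
    (A : W →L[ℂ] W) :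
    ‖(u : W →L[ℂ] W) * A * ((u⁻¹ : (W →L[ℂ] W)ˣ) : W →L[ℂ] W)‖ ≤ ‖A‖ := by
  refine ContinuousLinearMap.opNorm_le_bound _ (norm_nonneg _) fun v => ?_
  rw [mul_apply_eq_comp, mul_apply_eq_comp, norm_apply_of_star_mul_self hu,
    ← norm_apply_of_star_mul_self hu' v]
  exact A.le_opNorm _

/-- The action of a connected reductive group and a real character of the group, with the polar
decomposition attached to a maximal compact subgroup of unitary automorphisms. -/
noncomputable def polarRep [CompleteSpace W] {G H : Subgroup (W →L[ℂ] W)ˣ} (hG : IsConnectedReductive G)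
    (hH : IsMaximalCompact G H)
    (hunitary : ∀ h ∈ H, star (h : W →L[ℂ] W) * (h : W →L[ℂ] W) = 1) (χ : RealCharacter G) :
    PolarRep G (lieAlgebra H hH.isClosed) W where
  ρ := (Units.coeHom (W →L[ℂ] W)).comp G.subtype
  gen := iSMul H hH.isClosed
  e Y := ⟨expGL (Complex.I • (Y : W →L[ℂ] W)),
    hG.algebraic.expGL_smul_mem (fun t => hH.le (Y.2 t)) _⟩
  L g := logAbsSq G g χ
  ell := realCharForm hH.le hH.isClosed χ
  U := {g | (g : (W →L[ℂ] W)ˣ) ∈ H}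
  gen_selfAdjoint Y := by
    have h : star (Y : W →L[ℂ] W) = -Y := star_eq_neg_of_unitary fun t => by
      have h := hunitary _ (Y.2 t)
      rwa [val_expGL] at h
    rw [iSMul_apply, IsSelfAdjoint, star_smul, h]
    simp
  gen_injective Y hY := by
    rw [iSMul_apply, smul_eq_zero] at hY
    exact Subtype.ext (hY.resolve_left Complex.I_ne_zero)
  ρ_e Y := rfl
  L_mul g g' := logAbsSq_mul g g' χ
  L_U u hu := logAbsSq_eq_zero hH.le hH.compact χ hu
  L_e Y := logAbsSq_exp hG.algebraic hH.le hH.isClosed χ Y _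
  norm_U u hu v := norm_apply_of_star_mul_self (hunitary _ hu) v
  isCompact_U := by
    convert hH.compact.image Units.continuous_val using 1
    ext T
    constructor
    · rintro ⟨u, hu, rfl⟩
      exact ⟨u, hu, rfl⟩
    · rintro ⟨u, hu, rfl⟩
      exact ⟨⟨u, hH.le hu⟩, hu, rfl⟩
  exists_polar := by
    rintro ⟨γ, hγ⟩
    obtain ⟨h, hh, Y, hY, rfl⟩ := hG.exists_eq_mul_exp hH hγ
    exact ⟨⟨h, hH.le hh⟩, hh, ⟨Y, hY⟩, rfl⟩
  exists_inv := by
    intro u hu Y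
    -- (u exp(iY))⁻¹ = u⁻¹ exp(−i uYu⁻¹), and unitary conjugation does not increase the operator
    -- norm.
    refine ⟨u⁻¹, H.inv_mem hu, -Ad ⟨u, hu⟩ Y, ?_, ?_⟩
    · rw [norm_neg]
      exact norm_conj_le (hunitary _ hu) (hunitary _ (H.inv_mem hu)) _
    · ext1
      have h1 : Complex.I • ((-Ad ⟨u, hu⟩ Y : lieAlgebra H hH.isClosed) : W →L[ℂ] W) =
          ((u : (W →L[ℂ] W)ˣ) : W →L[ℂ] W) * (-(Complex.I • (Y : W →L[ℂ] W))) *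
            (((u : (W →L[ℂ] W)ˣ)⁻¹ : (W →L[ℂ] W)ˣ) : W →L[ℂ] W) := by
        rw [mul_neg, neg_mul, mul_smul_comm, smul_mul_assoc, ← smul_neg]
        rfl
      simp only [Subgroup.coe_inv, Subgroup.coe_mul, h1, expGL_conj, expGL_neg]
      group

theorem orbit_eq_range [CompleteSpace W] {G H : Subgroup (W →L[ℂ] W)ˣ}
    (hG : IsConnectedReductive G) (hH : IsMaximalCompact G H)
    (hunitary : ∀ h ∈ H, star (h : W →L[ℂ] W) * (h : W →L[ℂ] W) = 1) (χ : RealCharacter G) (x : W) :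
    orbit G x = Set.range fun γ => (polarRep hG hH hunitary χ).ρ γ x := by
  ext y
  constructor
  · rintro ⟨g, hg, rfl⟩
    exact ⟨⟨g, hg⟩, rfl⟩
  · rintro ⟨g, rfl⟩
    exact ⟨g, g.2, rfl⟩

/-- The stabilizer of `x` in `G`. -/
def stabilizer (G : Subgroup (W →L[ℂ] W)ˣ) (x : W) : Subgroup (W →L[ℂ] W)ˣ where
  carrier := {g | g ∈ G ∧ (g : W →L[ℂ] W) x = x}
  one_mem' := ⟨G.one_mem, by simp⟩
  mul_mem' := by
    rintro a b ⟨ha, hax⟩ ⟨hb, hbx⟩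
    exact ⟨G.mul_mem ha hb, by rw [Units.val_mul, mul_apply_eq_comp, hbx, hax]⟩
  inv_mem' := by
    rintro a ⟨ha, hax⟩
    refine ⟨G.inv_mem ha, ?_⟩
    conv_lhs => rw [← hax]
    rw [← mul_apply_eq_comp, Units.inv_mul, one_apply_eq_self]

theorem isClosed_stabilizer {G : Subgroup (W →L[ℂ] W)ˣ} (hG : IsClosed (G : Set (W →L[ℂ] W)ˣ))
    (x : W) : IsClosed (stabilizer G x : Set (W →L[ℂ] W)ˣ) :=
  hG.inter (isClosed_eq (Units.continuous_val.clm_apply continuous_const) continuous_const)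

/-- If the orbit map of `x` is constant along a one-parameter group, then its generator kills
`x`. -/
theorem apply_eq_zero_of_exp_smul_apply {A : W →L[ℂ] W} {x : W}
    (h : ∀ t : ℝ, NormedSpace.exp (t • A) x = x) : A x = 0 := by
  have h1 := ((ContinuousLinearMap.apply ℂ W x).restrictScalars ℝ).hasFDerivAt.comp_hasDerivAt
    (0 : ℝ) (hasDerivAt_exp A)
  have h2 : ((ContinuousLinearMap.apply ℂ W x).restrictScalars ℝ) ∘
      (fun t : ℝ => NormedSpace.exp (t • A)) = fun _ => x := funext h
  rw [h2] at h1
  exact h1.unique (hasDerivAt_const _ _)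

/-- A generator of a real one-parameter group fixing x kills x, so its complex multiples also fix x:
the stabilizer has a complex Lie algebra, as `finite_of_bounded` requires. -/
theorem stabilizer_finite {G : Subgroup (W →L[ℂ] W)ˣ} (hG : IsAlgebraicGroup G) {x : W} {C : ℝ}
    (hC : ∀ u ∈ stabilizer G x, ‖(u : W →L[ℂ] W)‖ ≤ C) :
    (stabilizer G x : Set (W →L[ℂ] W)ˣ).Finite := by
  refine finite_of_bounded (isClosed_stabilizer hG.isClosed x) (fun A hA z => ⟨?_, ?_⟩) hC
  · exact hG.expGL_smul_mem (fun t => (hA t).1) z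
  · have h1 : A x = 0 := apply_eq_zero_of_exp_smul_apply fun t => (hA t).2
    have h2 := exp_apply_of_eigen (A := z • A) (v := x) (c := 0) (by simp [h1])
    simpa using h2

/-- If the stabilizer of `x` is finite and contains `exp A`, with `A` self-adjoint, then
`A = 0`. -/
theorem eq_zero_of_finite_stabilizer [CompleteSpace W] {G : Subgroup (W →L[ℂ] W)ˣ} {x : W}
    (hfin : (stabilizer G x : Set (W →L[ℂ] W)ˣ).Finite) {A : W →L[ℂ] W} (hA : IsSelfAdjoint A)
    (hmem : expGL A ∈ stabilizer G x) : A = 0 := by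
  have hfin' : Finite (stabilizer G x) := hfin
  obtain ⟨n, hn, h⟩ := (isOfFinOrder_of_finite (⟨_, hmem⟩ : stabilizer G x)).exists_pow_eq_one
  have h1 : expGL A ^ n = 1 := congrArg Subtype.val h
  rw [← expGL_nsmul, ← Nat.cast_smul_eq_nsmul ℝ] at h1
  have h2 := eq_zero_of_exp_eq_one (A := (n : ℝ) • A) ((IsSelfAdjoint.all _).smul hA)
    (congrArg Units.val h1)
  exact (smul_eq_zero.1 h2).resolve_left (by positivity)

theorem finite_stabilizer_apply {G : Subgroup (W →L[ℂ] W)ˣ} {x : W}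
    (hfin : {g : (W →L[ℂ] W)ˣ | g ∈ G ∧ (g : W →L[ℂ] W) x = x}.Finite) {g : (W →L[ℂ] W)ˣ}
    (hg : g ∈ G) : (stabilizer G ((g : W →L[ℂ] W) x) : Set (W →L[ℂ] W)ˣ).Finite := by
  refine (hfin.image fun u => g * u * g⁻¹).subset ?_
  rintro u ⟨hu, hux⟩
  refine ⟨g⁻¹ * u * g, ⟨G.mul_mem (G.mul_mem (G.inv_mem hg) hu) hg, ?_⟩, by group⟩
  rw [Units.val_mul, Units.val_mul, mul_apply_eq_comp, mul_apply_eq_comp, hux,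
    ← mul_apply_eq_comp, Units.inv_mul, one_apply_eq_self]

theorem orbit_apply {G : Subgroup (W →L[ℂ] W)ˣ} {g : (W →L[ℂ] W)ˣ} (hg : g ∈ G) (x : W) :
    orbit G ((g : W →L[ℂ] W) x) = orbit G x := by
  ext y
  constructor
  · rintro ⟨k, hk, rfl⟩
    exact ⟨k * g, G.mul_mem hk hg, by simp⟩
  · rintro ⟨k, hk, rfl⟩
    refine ⟨k * g⁻¹, G.mul_mem hk (G.inv_mem hg), ?_⟩
    rw [← mul_apply_eq_comp, ← Units.val_mul, inv_mul_cancel_right]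

theorem orbit_subset_semistableSet {G : Subgroup (W →L[ℂ] W)ˣ} {X : Set W} {χ : RealCharacter G}
    (hGX : ∀ g ∈ G, ∀ x ∈ X, (g : W →L[ℂ] W) x ∈ X) {x : W} (hx : x ∈ semistableSet G X χ) :
    orbit G x ⊆ semistableSet G X χ := by
  rintro _ ⟨g, hg, rfl⟩
  refine ⟨hGX g hg x hx.1, ?_⟩
  rw [orbit_apply hg]
  exact hx.2

theorem exists_norm_le_of_tendsto {E : Type*} [NormedAddCommGroup E] {f : ℝ → E}
    (hf : Continuous f) {y : E} (hy : Tendsto f atTop (𝓝 y)) : ∃ M, ∀ t, 0 ≤ t → ‖f t‖ ≤ M := by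
  obtain ⟨T, hT⟩ := eventually_atTop.1 (hy.norm.eventually_le_const (lt_add_one ‖y‖))
  obtain ⟨C, hC⟩ := (isCompact_Icc (a := (0 : ℝ)) (b := T)).exists_bound_of_continuousOn
    hf.continuousOn
  refine ⟨max C (‖y‖ + 1), fun t ht => ?_⟩
  rcases le_total t T with h | h
  · exact (hC t ⟨ht, h⟩).trans (le_max_left _ _)
  · exact (hT t h).trans (le_max_right _ _)

end Main

end KempfNess

theorem theorem2 {W : Type*} [NormedAddCommGroup W] [InnerProductSpace ℂ W]
    [FiniteDimensional ℂ W]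
    (G : Subgroup (W →L[ℂ] W)ˣ) (hG : KempfNess.IsConnectedReductive G)
    (H : Subgroup (W →L[ℂ] W)ˣ) (hH : KempfNess.IsMaximalCompact G H)
    (hunitary : ∀ h ∈ H, ∀ u v : W,
      ⟪(h : W →L[ℂ] W) u, (h : W →L[ℂ] W) v⟫_ℂ = ⟪u, v⟫_ℂ)
    (X : Set W) (hX : KempfNess.IsZariskiClosed X)
    (hGX : ∀ g ∈ G, ∀ x ∈ X, (g : W →L[ℂ] W) x ∈ X)
    (B : KempfNess.InvariantScalarProduct H hH.isClosed)
    (χ : KempfNess.RealCharacter G) (x : W) (hx : x ∈ X) :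
    KempfNess.IsStable G X χ x ↔
      ∀ Y : KempfNess.lieAlgebra H hH.isClosed, Y ≠ 0 →
        (∃ y ∈ X, Filter.Tendsto
          (fun t : ℝ => (KempfNess.expGL ((Complex.I * (t : ℂ)) • (Y : W →L[ℂ] W)) :
            W →L[ℂ] W) x) Filter.atTop (nhds y)) →
        B.form (B.iota hH.le χ) Y < 0 := by
  have hcomplete : CompleteSpace W := FiniteDimensional.complete ℂ W
  have hfd : FiniteDimensional ℝ (W →L[ℂ] W) := FiniteDimensional.complexToReal (W →L[ℂ] W)
  have hstar : ∀ h ∈ H, star (h : W →L[ℂ] W) * (h : W →L[ℂ] W) = 1 := fun h hh =>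
    KempfNess.star_mul_self_of_inner_eq (hunitary h hh)
  set P := KempfNess.polarRep hG hH hstar χ with hP
  have horbit := KempfNess.orbit_eq_range hG hH hstar χ
  rw [← hP] at horbit
  have hray : ∀ (Y : KempfNess.lieAlgebra H hH.isClosed) (t : ℝ),
      (KempfNess.expGL ((Complex.I * (t : ℂ)) • (Y : W →L[ℂ] W)) : W →L[ℂ] W) =
        NormedSpace.exp (t • P.gen Y) := by
    intro Y t
    rw [KempfNess.val_expGL, mul_comm, mul_smul, Complex.coe_smul]
    rfl
  have hcrit : ∀ z : W, (∀ g : G, KempfNess.kempfNess G χ z 1 ≤ KempfNess.kempfNess G χ z g) ↔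
      ∀ Y, P.energy z 0 ≤ P.energy z Y := fun z => P.energy_zero_le_iff.symm
  have hXclosed : IsClosed X := hX.isClosed
  have hclosure : ∀ y ∈ X, closure (KempfNess.orbit G y) ⊆ X := by
    intro y hy
    refine closure_minimal ?_ hXclosed
    rintro _ ⟨g, hg, rfl⟩
    exact hGX g hg y hy
  simp only [KempfNess.InvariantScalarProduct.form_iota, hray]
  constructor
  · intro hstable Y hY hlim
    obtain ⟨-, z, hzx, hz⟩ := hstable.semistable
    -- The minimal point z is semistable through its own orbit, so relative closedness of the orbit
    -- of x puts z in that orbit.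
    have hzs : z ∈ KempfNess.semistableSet G X χ :=
      ⟨hclosure x hx hzx, z, subset_closure ⟨1, G.one_mem, by simp⟩, hz⟩
    have hzorbit : z ∈ KempfNess.orbit G x := by
      have h1 : (⟨z, hzs⟩ : KempfNess.semistableSet G X χ) ∈
          closure ((↑) ⁻¹' KempfNess.orbit G x) := by
        rw [closure_subtype, Subtype.image_preimage_coe, Set.inter_eq_right.2
          (KempfNess.orbit_subset_semistableSet hGX hstable.semistable)]
        exact hzx
      rwa [hstable.orbit_closed.closure_eq] at h1
    rw [horbit] at hzorbit
    obtain ⟨g, rfl⟩ := hzorbit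
    have hstab : ∀ Z, NormedSpace.exp (P.gen Z) (P.ρ g x) = P.ρ g x → Z = 0 := by
      intro Z hZ
      refine P.gen_injective Z (KempfNess.eq_zero_of_finite_stabilizer
        (KempfNess.finite_stabilizer_apply hstable.finite_stabilizer g.2)
        (P.gen_selfAdjoint Z) ⟨(P.e Z).2, hZ⟩)
    obtain ⟨a, ha, b, hgrowth⟩ := P.exists_growth_of_min ((hcrit _).1 hz) hstab
    obtain ⟨y, -, hy⟩ := hlim
    obtain ⟨M, hM⟩ := KempfNess.exists_norm_le_of_tendsto
      (f := fun t : ℝ => NormedSpace.exp (t • P.gen Y) x)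
      ((KempfNess.continuous_exp_endo.comp (continuous_id.smul continuous_const)).clm_apply
        continuous_const) hy
    exact P.ell_neg_of_growth ha hgrowth hY (M := M ^ 2)
      fun t ht => pow_le_pow_left₀ (norm_nonneg _) (hM t ht) 2
  · intro h
    have hgrowth : ∃ a > 0, ∃ b : ℝ, ∀ Y, a * ‖Y‖ - b ≤ P.energy x Y := by
      refine P.exists_growth fun Y hY => P.exists_energy_lt_of_ray ?_
      rintro ⟨y, hy⟩
      -- A limit in W automatically lies in X, as X is closed and G-stable.
      refine h Y hY ⟨y, hXclosed.mem_of_tendsto hy (Eventually.of_forall fun t => ?_), hy⟩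
      rw [← hray]
      exact hGX _ (hG.algebraic.expGL_smul_mem (fun t => hH.le (Y.2 t)) _) x hx
    obtain ⟨a, ha, b, hgrowth⟩ := hgrowth
    refine ⟨⟨hx, ?_⟩, ?_, ?_⟩
    · obtain ⟨γ, hγ⟩ := P.exists_phi_min ha hgrowth
      refine ⟨P.ρ γ x, subset_closure ?_, P.phi_one_le_of_min hγ⟩
      rw [horbit]
      exact ⟨γ, rfl⟩
    · refine isClosed_of_closure_subset fun y hy => ?_
      have hyx : (y : W) ∈ closure (KempfNess.orbit G x) :=
        closure_mono (Set.image_preimage_subset _ _)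
          (image_closure_subset_closure_image continuous_subtype_val ⟨y, hy, rfl⟩)
      obtain ⟨-, z, hzy, hz⟩ := y.2
      rw [horbit] at hyx hzy
      change (y : W) ∈ KempfNess.orbit G x
      rw [horbit]
      exact P.mem_orbit_of_mem_closure ha hgrowth ((hcrit z).1 hz) hzy hyx
    · obtain ⟨C, hC⟩ := P.exists_norm_stabilizer_le ha hgrowth
      exact KempfNess.stabilizer_finite hG.algebraic (x := x) (C := C)
        fun u hu => hC ⟨u, hu.1⟩ hu.2
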